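/- Let $(X,d)$ be a locally compact, second countable metric space with a nonzero finite Borel measure $\mu$, and let $\delta>0$. Suppose that $(X,d,\mu)$ is Ahlfors $\delta$-regular: there is $C\ge 1$ with $C^{-1}r^\delta\le\mu(\overline B(x,r))\le Cr^\delta$ for all $x\in X$ and $0\le r<\operatorname{diam}X$. Let $\operatorname{Din}_{\mathbb C}(X,d)$ be the unital $*$-algebra of bounded uniformly continuous functions $h:X\to\mathbb C$ with $\int_0^1\omega_h(t)\,\frac{dt}{t}<\infty$, where $\omega_h(t)=\sup\{|h(x)-h(y)|: d(x,y)\le t\operatorname{diam}X\}$, represented on $L^2_{\mathbb C}(X,\mu)$ by the multiplication operators $\mathrm m_hf=hf$. Let $\Delta_{\mathbb C}$ (the complex logarithmic Dirichlet Laplacian) be the operator in $L^2_{\mathbb C}(X,\mu)$ associated with the form $$\mathcal E_{\mathbb C}(f,g)=\frac12\int_X\int_X\frac{\overline{(f(x)-f(y))}\,(g(x)-g(y))}{d(x,y)^{\delta}}\,d\mu(y)\,d\mu(x)$$ (the integral being over $X\times X$ without the diagonal) with domain $\operatorname{Dom}\mathcal E_{\mathbb C}=\{f\in L^2_{\mathbb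 C}(X,\mu):\mathcal E_{\mathbb C}(f,f)<\infty\}$; that is, $f\in\operatorname{Dom}\Delta_{\mathbb C}$ with $\Delta_{\mathbb C}f=u$ if and only if $f\in\operatorname{Dom}\mathcal E_{\mathbb C}$ and $\mathcal E_{\mathbb C}(f,g)=\langle u,g\rangle$ for all $g\in\operatorname{Dom}\mathcal E_{\mathbb C}$. Then $(\operatorname{Din}_{\mathbb C}(X,d),L^2_{\mathbb C}(X,\mu),\Delta_{\mathbb C})$ is an $\operatorname{Li}$-summable spectral triple, that is: 1. the $*$-representation $h\mapsto\mathrm m_h$ of $\operatorname{Din}_{\mathbb C}(X,d)$ in $\mathbb B(L^2_{\mathbb C}(X,\mu))$ is unital and faithful; 2. $\Delta_{\mathbb C}$ is self-adjoint with compact resolvent; 3. for every $h\in\operatorname{Din}_{\mathbb C}(X,d)$ one has $\mathrm m_h(\operatorname{Dom}\Delta_{\mathbb C})\subset\operatorname{Dom}\Delta_{\mathbb C}$, and $[\Delta_{\mathbb C},\mathrm m_h]$ extends to a bounded operator on $L^2_{\mathbb C}(X,\mu)$; 4. for some $t>0$ the operator $e^{-t|\Delta_{\mathbb C}|}$ is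 trace class, where $|\Delta_{\mathbb C}|=(\Delta_{\mathbb C}^*\Delta_{\mathbb C})^{1/2}$. In particular $e^{-t\Delta_{\mathbb C}}$ is trace class for some $t>0$. -/

import Mathlib

set_option linter.unusedSectionVars false

noncomputable section

namespace LogLaplacian

open MeasureTheory Filter Topology
open scoped ENNReal

/-! ### Unbounded operators on a complex Hilbert space -/

section Operators

variable {H : Type*} [NormedAddCommGroup H] [InnerProductSpace ℂ H]

/-- `R` is the resolvent `(D - z)⁻¹`: a bounded everywhere defined two-sided inverse of
`D - z : Dom D → H`. The existence of such an `R` says that `z` is in the resolvent set of `D`. -/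
def IsResolvent (D : H →ₗ.[ℂ] H) (z : ℂ) (R : H →L[ℂ] H) : Prop :=
  (∀ u : H, ∃ h : R u ∈ D.domain, D ⟨R u, h⟩ - z • R u = u) ∧
    ∀ x : D.domain, R (D x - z • (x : H)) = x

/-- `D` has non-empty resolvent set and all its resolvents are compact operators. -/
def HasCompactResolvent (D : H →ₗ.[ℂ] H) : Prop :=
  (∃ (z : ℂ) (R : H →L[ℂ] H), IsResolvent D z R) ∧
    ∀ (z : ℂ) (R : H →L[ℂ] H), IsResolvent D z R → IsCompactOperator R

/-- `(x, y)` is in the graph of the composition `S ∘ T`, whose domain is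
`{x ∈ Dom T | T x ∈ Dom S}`. -/
def InCompGraph (S T : H →ₗ.[ℂ] H) (x y : H) : Prop :=
  ∃ u : H, (x, u) ∈ T.graph ∧ (u, y) ∈ S.graph

/-- `(S t)_{t ≥ 0}` is the strongly continuous one-parameter semigroup of bounded operators with
infinitesimal generator `-B` (domains included), that is, `S t = e^{-tB}` for all `t ≥ 0`. A
strongly continuous semigroup is determined by its generator. The values of `S` at negative
times are irrelevant. -/
structure IsHeatSemigroup (B : H →ₗ.[ℂ] H) (S : ℝ → H →L[ℂ] H) : Prop where
  map_zero : S 0 = 1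
  map_add : ∀ s t : ℝ, 0 ≤ s → 0 ≤ t → S (s + t) = S s * S t
  strongly_continuous : ∀ x : H, Tendsto (fun t : ℝ => S t x) (𝓝[>] 0) (𝓝 x)
  generator : ∀ x y : H,
    (x, y) ∈ (-B).graph ↔
      Tendsto (fun t : ℝ => ((t⁻¹ : ℝ) : ℂ) • (S t x - x)) (𝓝[>] 0) (𝓝 y)

variable [CompleteSpace H]

/-- `B` is the absolute value `|D| = (D* D)^{1/2}`, that is, the (unique) positive self-adjoint
operator with `B ∘ B = D* ∘ D`, domains included. -/
structure IsAbsoluteValue (D B : H →ₗ.[ℂ] H) : Prop where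
  selfAdjoint : IsSelfAdjoint B
  nonneg : ∀ x : B.domain, 0 ≤ (inner ℂ (x : H) (B x)).re
  sq_eq : ∀ x y : H, InCompGraph B B x y ↔ InCompGraph D.adjoint D x y

/-- A bounded operator `T` is trace class when `|T| = (T* T)^{1/2}` has finite trace, computed in
an orthonormal basis (by positivity of `|T|` the choice of the basis does not matter, and every
Hilbert space has one). -/
def IsTraceClass (T : H →L[ℂ] H) : Prop :=
  ∃ (w : Set H) (b : HilbertBasis w ℂ H),
    Summable fun i => (inner ℂ (b i) (CFC.abs T (b i))).re

/-- `(𝒜, H, D)` is a spectral triple: `𝒜` is a complex unital `*`-algebra, embedded in `𝔹(H)` by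
the faithful unital `*`-representation `π`, and `D` is a self-adjoint operator in `H` with compact
resolvent such that each `a ∈ 𝒜` preserves `Dom D` and the commutator `[D, a] : Dom D → H`
extends to a bounded operator on `H`. -/
structure IsSpectralTriple {A : Type*} [Ring A] [StarRing A] [Algebra ℂ A] [StarModule ℂ A]
    (π : A →⋆ₐ[ℂ] (H →L[ℂ] H)) (D : H →ₗ.[ℂ] H) : Prop where
  faithful : Function.Injective π
  selfAdjoint : IsSelfAdjoint D
  compact_resolvent : HasCompactResolvent D
  map_domain : ∀ (a : A) (x : D.domain), π a x ∈ D.domain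
  bounded_commutator : ∀ a : A, ∃ K : H →L[ℂ] H, ∀ x : D.domain,
    D ⟨π a x, map_domain a x⟩ - π a (D x) = K x

/-- The heat operator `e^{-t|D|}` is trace class for some `t > 0`. -/
def IsLiSummable (D : H →ₗ.[ℂ] H) : Prop :=
  ∃ (B : H →ₗ.[ℂ] H) (S : ℝ → H →L[ℂ] H),
    IsAbsoluteValue D B ∧ IsHeatSemigroup B S ∧ ∃ t : ℝ, 0 < t ∧ IsTraceClass (S t)

end Operators

/-! ### Ahlfors regularity and Dini continuous functions -/

section Metric

variable {X : Type*} [MetricSpace X]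

/-- Ahlfors `δ`-regularity. The diameter is taken in `[0, ∞]`. -/
def IsAhlforsRegular [MeasurableSpace X] (μ : Measure X) (δ : ℝ) : Prop :=
  0 < δ ∧ ∃ C : ℝ, 1 ≤ C ∧ ∀ (x : X) (r : ℝ), 0 ≤ r →
    ENNReal.ofReal r < Metric.ediam (Set.univ : Set X) →
      ENNReal.ofReal (C⁻¹ * r ^ δ) ≤ μ (Metric.closedBall x r) ∧
        μ (Metric.closedBall x r) ≤ ENNReal.ofReal (C * r ^ δ)

/-- The modulus of continuity `ω_f(t) = sup {|f x - f y| : d(x,y) ≤ t diam X}`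
(for a bounded metric space `X`). -/
def modulus (f : X → ℂ) (t : ℝ) : ℝ≥0∞ :=
  ⨆ (x : X) (y : X) (_ : dist x y ≤ t * Metric.diam (Set.univ : Set X)), ‖f x - f y‖ₑ

/-- The Dini constant `Din(f) = ∫₀¹ ω_f(t) / t dt`. -/
def diniConst (f : X → ℂ) : ℝ≥0∞ :=
  ∫⁻ t in Set.Ioc (0 : ℝ) 1, modulus f t / ENNReal.ofReal t

lemma modulus_mono (f : X → ℂ) : Monotone (modulus f) := by
  intro s t hst
  refine iSup_mono fun x => iSup_mono fun y => iSup_mono' fun h => ⟨h.trans ?_, le_rfl⟩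
  exact mul_le_mul_of_nonneg_right hst Metric.diam_nonneg

lemma measurable_modulus (f : X → ℂ) : Measurable (modulus f) :=
  (modulus_mono f).measurable

lemma le_modulus (f : X → ℂ) {t : ℝ} {x y : X}
    (h : dist x y ≤ t * Metric.diam (Set.univ : Set X)) : ‖f x - f y‖ₑ ≤ modulus f t :=
  le_iSup_of_le x (le_iSup_of_le y (le_iSup_of_le h le_rfl))

/-- If `ω_f ≤ a ω_g + b ω_k` then finiteness of the Dini constants passes to `f`. -/
lemma diniConst_lt_top_of_le {f g k : X → ℂ} {a b : ℝ≥0∞} (ha : a ≠ ∞) (hb : b ≠ ∞)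
    (h : ∀ x y, ‖f x - f y‖ₑ ≤ a * ‖g x - g y‖ₑ + b * ‖k x - k y‖ₑ)
    (hg : diniConst g < ∞) (hk : diniConst k < ∞) : diniConst f < ∞ := by
  have hm : ∀ t, modulus f t ≤ a * modulus g t + b * modulus k t := by
    intro t
    refine iSup_le fun x => iSup_le fun y => iSup_le fun hxy => (h x y).trans ?_
    gcongr
    · exact le_modulus g hxy
    · exact le_modulus k hxy
  have hq : ∀ u : X → ℂ, Measurable fun t : ℝ => modulus u t / ENNReal.ofReal t := fun u =>
    (measurable_modulus u).div ENNReal.measurable_ofReal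
  calc diniConst f
      ≤ ∫⁻ t in Set.Ioc (0 : ℝ) 1, (a * (modulus g t / ENNReal.ofReal t)
          + b * (modulus k t / ENNReal.ofReal t)) := by
        refine lintegral_mono fun t => ?_
        refine (ENNReal.div_le_div_right (hm t) _).trans_eq ?_
        rw [ENNReal.add_div, mul_div_assoc, mul_div_assoc]
    _ = a * diniConst g + b * diniConst k := by
        rw [lintegral_add_left ((hq g).const_mul a), lintegral_const_mul _ (hq g),
          lintegral_const_mul _ (hq k)]
        rfl
    _ < ∞ := by
        exact ENNReal.add_lt_top.2
          ⟨ENNReal.mul_lt_top ha.lt_top hg, ENNReal.mul_lt_top hb.lt_top hk⟩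

lemma diniConst_const (c : ℂ) : diniConst (fun _ : X => c) = 0 := by
  simp [diniConst, modulus]

variable (X) in
/-- The unital `*`-algebra `Din_ℂ(X,d)` of complex Dini continuous functions: bounded uniformly
continuous functions with finite Dini constant, with pointwise operations. -/
def diniAlgebra : StarSubalgebra ℂ (BoundedContinuousFunction X ℂ) where
  carrier := {f | UniformContinuous f ∧ diniConst f < ∞}
  algebraMap_mem' c := by
    refine ⟨?_, ?_⟩
    · exact uniformContinuous_const (b := c)
    · exact (diniConst_const (X := X) c).trans_lt ENNReal.zero_lt_top
  add_mem' := by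
    rintro f g ⟨hf, hf'⟩ ⟨hg, hg'⟩
    refine ⟨hf.add hg, diniConst_lt_top_of_le (a := 1) (b := 1) (by simp) (by simp) ?_ hf' hg'⟩
    intro x y
    rw [one_mul, one_mul]
    refine le_trans (le_of_eq ?_) (enorm_add_le _ _)
    congr 1
    simp only [BoundedContinuousFunction.coe_add, Pi.add_apply]
    ring
  mul_mem' := by
    rintro f g ⟨hf, hf'⟩ ⟨hg, hg'⟩
    have key : ∀ x y, ‖(f * g) x - (f * g) y‖ ≤ ‖f‖ * ‖g x - g y‖ + ‖g‖ * ‖f x - f y‖ := by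
      intro x y
      have e : (f * g) x - (f * g) y = f x * (g x - g y) + (f x - f y) * g y := by
        simp only [BoundedContinuousFunction.coe_mul, Pi.mul_apply]
        ring
      rw [e]
      refine (norm_add_le _ _).trans ?_
      rw [norm_mul, norm_mul, mul_comm ‖f x - f y‖]
      gcongr
      · exact f.norm_coe_le_norm x
      · exact g.norm_coe_le_norm y
    refine ⟨?_, diniConst_lt_top_of_le (a := ‖f‖ₑ) (b := ‖g‖ₑ) (by simp) (by simp) ?_ hg' hf'⟩
    · rw [Metric.uniformContinuous_iff] at hf hg ⊢
      intro ε hε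
      have hpos : 0 < ‖f‖ + ‖g‖ + 1 := by positivity
      obtain ⟨a, ha, hfa⟩ := hf (ε / (‖f‖ + ‖g‖ + 1)) (by positivity)
      obtain ⟨b, hb, hgb⟩ := hg (ε / (‖f‖ + ‖g‖ + 1)) (by positivity)
      refine ⟨min a b, lt_min ha hb, fun {x y} hxy => ?_⟩
      have h1 := hfa (hxy.trans_le (min_le_left _ _))
      have h2 := hgb (hxy.trans_le (min_le_right _ _))
      rw [dist_eq_norm] at h1 h2 ⊢
      calc _ ≤ ‖f‖ * ‖g x - g y‖ + ‖g‖ * ‖f x - f y‖ := key x y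
        _ ≤ ‖f‖ * (ε / (‖f‖ + ‖g‖ + 1)) + ‖g‖ * (ε / (‖f‖ + ‖g‖ + 1)) := by gcongr
        _ = (‖f‖ + ‖g‖) * (ε / (‖f‖ + ‖g‖ + 1)) := by ring
        _ < (‖f‖ + ‖g‖ + 1) * (ε / (‖f‖ + ‖g‖ + 1)) := by
            have : 0 < ε / (‖f‖ + ‖g‖ + 1) := by positivity
            nlinarith
        _ = ε := by field_simp
    · intro x y
      have := key x y
      rw [← ofReal_norm, ← ofReal_norm, ← ofReal_norm, ← ofReal_norm, ← ofReal_norm,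
        ← ENNReal.ofReal_mul (norm_nonneg _), ← ENNReal.ofReal_mul (norm_nonneg _),
        ← ENNReal.ofReal_add (by positivity) (by positivity)]
      exact ENNReal.ofReal_le_ofReal this
  star_mem' := by
    rintro f ⟨hf, hf'⟩
    refine ⟨?_, diniConst_lt_top_of_le (a := 1) (b := 0) (g := f) (k := f)
      (by simp) (by simp) ?_ hf' hf'⟩
    · exact (Complex.isometry_conj.uniformContinuous).comp hf
    · intro x y
      rw [one_mul, zero_mul, add_zero]
      refine le_of_eq ?_
      have e : (star f) x - (star f) y = star (f x - f y) := by
        simp [BoundedContinuousFunction.star_apply]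
      rw [e, ← ofReal_norm, ← ofReal_norm, norm_star]

end Metric

/-! ### The representation of Dini functions by multiplication operators -/

section Multiplication

variable {X : Type*} [MetricSpace X] [MeasurableSpace X] [BorelSpace X]
  [SecondCountableTopology X] (μ : Measure X)

lemma memLp_mul (h : BoundedContinuousFunction X ℂ) (f : Lp ℂ 2 μ) :
    MemLp (fun x => h x * f x) 2 μ :=
  (Lp.memLp f).of_le_mul (c := ‖h‖)
    (h.continuous.aestronglyMeasurable.mul (Lp.aestronglyMeasurable f))
    (Eventually.of_forall fun x => by
      rw [norm_mul]
      exact mul_le_mul_of_nonneg_right (h.norm_coe_le_norm x) (norm_nonneg _))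

/-- The multiplication operator `m_h f = h f` on `L²_ℂ(X,μ)`. -/
def mulOp (h : BoundedContinuousFunction X ℂ) : Lp ℂ 2 μ →L[ℂ] Lp ℂ 2 μ :=
  LinearMap.mkContinuous
    { toFun := fun f => (memLp_mul μ h f).toLp
      map_add' := fun f g => by
        rw [← MemLp.toLp_add]
        refine MemLp.toLp_congr _ _ ?_
        filter_upwards [Lp.coeFn_add f g] with x hx
        rw [hx, Pi.add_apply, Pi.add_apply, mul_add]
      map_smul' := fun c f => by
        rw [RingHom.id_apply, ← MemLp.toLp_const_smul]
        refine MemLp.toLp_congr _ _ ?_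
        filter_upwards [Lp.coeFn_smul c f] with x hx
        simp [hx, mul_left_comm] }
    ‖h‖ (fun f => by
      refine Lp.norm_le_mul_norm_of_ae_le_mul ?_
      filter_upwards [(memLp_mul μ h f).coeFn_toLp] with x hx
      rw [LinearMap.coe_mk, AddHom.coe_mk, hx, norm_mul]
      exact mul_le_mul_of_nonneg_right (h.norm_coe_le_norm x) (norm_nonneg _))

lemma coeFn_mulOp (h : BoundedContinuousFunction X ℂ) (f : Lp ℂ 2 μ) :
    mulOp μ h f =ᵐ[μ] fun x => h x * f x :=
  (memLp_mul μ h f).coeFn_toLp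

lemma mulOp_star (h : BoundedContinuousFunction X ℂ) :
    mulOp μ (star h) = star (mulOp μ h) := by
  rw [ContinuousLinearMap.star_eq_adjoint, ContinuousLinearMap.eq_adjoint_iff]
  intro f g
  rw [L2.inner_def, L2.inner_def]
  refine integral_congr_ae ?_
  filter_upwards [coeFn_mulOp μ (star h) f, coeFn_mulOp μ h g] with x hx hy
  simp only [hx, hy, BoundedContinuousFunction.star_apply, RCLike.inner_apply, map_mul,
    RCLike.star_def, RingHomCompTriple.comp_apply, RingHom.id_apply]
  ring

/-- The embedding `Din_ℂ(X,d) → 𝔹(L²_ℂ(X,μ))`, `h ↦ m_h`, as a unital `*`-homomorphism. -/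
def diniRep : diniAlgebra X →⋆ₐ[ℂ] (Lp ℂ 2 μ →L[ℂ] Lp ℂ 2 μ) where
  toFun h := mulOp μ h
  map_one' := by
    ext1 f
    refine Lp.ext ?_
    filter_upwards [coeFn_mulOp μ ((1 : diniAlgebra X) : BoundedContinuousFunction X ℂ) f]
      with x hx
    rw [hx]
    simp
  map_mul' h k := by
    ext1 f
    refine Lp.ext ?_
    filter_upwards [coeFn_mulOp μ ((h * k : diniAlgebra X) : BoundedContinuousFunction X ℂ) f,
      coeFn_mulOp μ (h : BoundedContinuousFunction X ℂ) (mulOp μ k f),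
      coeFn_mulOp μ (k : BoundedContinuousFunction X ℂ) f] with x h1 h2 h3
    rw [mul_apply_eq_comp, h1, h2, h3]
    simp [mul_assoc]
  map_zero' := by
    ext1 f
    refine Lp.ext ?_
    filter_upwards [coeFn_mulOp μ ((0 : diniAlgebra X) : BoundedContinuousFunction X ℂ) f,
      Lp.coeFn_zero ℂ 2 μ] with x h1 h2
    rw [zero_apply, h1, h2]
    simp
  map_add' h k := by
    ext1 f
    refine Lp.ext ?_
    filter_upwards [coeFn_mulOp μ ((h + k : diniAlgebra X) : BoundedContinuousFunction X ℂ) f,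
      Lp.coeFn_add (mulOp μ h f) (mulOp μ k f),
      coeFn_mulOp μ (h : BoundedContinuousFunction X ℂ) f,
      coeFn_mulOp μ (k : BoundedContinuousFunction X ℂ) f] with x h1 h2 h3 h4
    rw [add_apply, h1, h2, Pi.add_apply, h3, h4]
    simp [add_mul]
  commutes' c := by
    ext1 f
    refine Lp.ext ?_
    rw [Algebra.algebraMap_eq_smul_one, Algebra.algebraMap_eq_smul_one]
    filter_upwards [coeFn_mulOp μ ((c • 1 : diniAlgebra X) : BoundedContinuousFunction X ℂ) f,
      Lp.coeFn_smul c f] with x h1 h2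
    rw [smul_apply, one_apply_eq_self, h1, h2]
    simp
  map_star' h := mulOp_star μ h

end Multiplication

/-! ### The logarithmic Dirichlet form and its operator -/

section Form

variable {X : Type*} [MetricSpace X] [MeasurableSpace X] [BorelSpace X]
  [SecondCountableTopology X] (μ : Measure X) [IsFiniteMeasure μ] (δ : ℝ)

/-- `f ∈ L²_ℂ(X,μ)` is in the form domain: `∫∫ |f x - f y|² / d(x,y)^δ dμ dμ < ∞`. For `δ > 0`
the integrand vanishes on the diagonal, because Lean sets `0 / 0 = 0`, so that this is the
integral over the complement of the diagonal. -/
def InFormDomain (f : Lp ℂ 2 μ) : Prop :=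
  Integrable (fun p : X × X => ‖f p.1 - f p.2‖ ^ 2 / dist p.1 p.2 ^ δ) (μ.prod μ)

/-- The form `𝓔_ℂ(f,g) = ½ ∫∫ conj (f x - f y) (g x - g y) / d(x,y)^δ dμ dμ`. -/
def logForm (f g : Lp ℂ 2 μ) : ℂ :=
  (1 / 2 : ℂ) * ∫ p : X × X,
    starRingEnd ℂ (f p.1 - f p.2) * (g p.1 - g p.2) / ((dist p.1 p.2 ^ δ : ℝ) : ℂ) ∂(μ.prod μ)

variable {μ}

lemma measurable_diff (f : Lp ℂ 2 μ) : Measurable fun p : X × X => f p.1 - f p.2 :=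
  ((Lp.stronglyMeasurable f).measurable.comp measurable_fst).sub
    ((Lp.stronglyMeasurable f).measurable.comp measurable_snd)

lemma measurable_weight : Measurable fun p : X × X => dist p.1 p.2 ^ δ :=
  (measurable_fst.dist measurable_snd).pow_const δ

lemma diff_add (f g : Lp ℂ 2 μ) : ∀ᵐ p ∂(μ.prod μ),
    (f + g) p.1 - (f + g) p.2 = (f p.1 - f p.2) + (g p.1 - g p.2) := by
  have h := Lp.coeFn_add f g
  filter_upwards [Measure.quasiMeasurePreserving_fst.ae h,
    Measure.quasiMeasurePreserving_snd.ae h] with p h1 h2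
  rw [h1, h2, Pi.add_apply, Pi.add_apply]
  ring

lemma diff_smul (c : ℂ) (f : Lp ℂ 2 μ) : ∀ᵐ p ∂(μ.prod μ),
    (c • f) p.1 - (c • f) p.2 = c * (f p.1 - f p.2) := by
  have h := Lp.coeFn_smul c f
  filter_upwards [Measure.quasiMeasurePreserving_fst.ae h,
    Measure.quasiMeasurePreserving_snd.ae h] with p h1 h2
  rw [h1, h2, Pi.smul_apply, Pi.smul_apply, smul_eq_mul, smul_eq_mul]
  ring

lemma InFormDomain.zero : InFormDomain μ δ 0 := by
  refine (integrable_zero (X × X) ℝ (μ.prod μ)).congr ?_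
  have h := Lp.coeFn_zero ℂ 2 μ
  filter_upwards [Measure.quasiMeasurePreserving_fst.ae h,
    Measure.quasiMeasurePreserving_snd.ae h] with p h1 h2
  rw [h1, h2]
  simp

variable {δ}

lemma InFormDomain.add {f g : Lp ℂ 2 μ} (hf : InFormDomain μ δ f) (hg : InFormDomain μ δ g) :
    InFormDomain μ δ (f + g) := by
  refine ((hf.const_mul 2).add (hg.const_mul 2)).mono'
    (((measurable_diff _).norm.pow_const 2).div (measurable_weight δ)).aestronglyMeasurable ?_
  filter_upwards [diff_add f g] with p hp
  have hw : 0 ≤ dist p.1 p.2 ^ δ := Real.rpow_nonneg dist_nonneg _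
  rw [hp, Real.norm_of_nonneg (by positivity), Pi.add_apply, ← mul_div_assoc, ← mul_div_assoc,
    ← add_div]
  refine div_le_div_of_nonneg_right ?_ hw
  have h1 := norm_add_le (f p.1 - f p.2) (g p.1 - g p.2)
  have h2 : ‖f p.1 - f p.2 + (g p.1 - g p.2)‖ ^ 2
      ≤ (‖f p.1 - f p.2‖ + ‖g p.1 - g p.2‖) ^ 2 := by gcongr
  nlinarith [sq_nonneg (‖f p.1 - f p.2‖ - ‖g p.1 - g p.2‖)]

lemma InFormDomain.smul (c : ℂ) {f : Lp ℂ 2 μ} (hf : InFormDomain μ δ f) :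
    InFormDomain μ δ (c • f) := by
  refine (hf.const_mul (‖c‖ ^ 2)).congr ?_
  filter_upwards [diff_smul c f] with p hp
  rw [hp, norm_mul]
  ring

lemma integrable_form {f g : Lp ℂ 2 μ} (hf : InFormDomain μ δ f) (hg : InFormDomain μ δ g) :
    Integrable (fun p : X × X => starRingEnd ℂ (f p.1 - f p.2) * (g p.1 - g p.2) /
      ((dist p.1 p.2 ^ δ : ℝ) : ℂ)) (μ.prod μ) := by
  refine (Integrable.add hf hg).mono' ?_ (Eventually.of_forall fun p => ?_)
  · refine Measurable.aestronglyMeasurable ?_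
    exact ((Complex.continuous_conj.measurable.comp (measurable_diff f)).mul
      (measurable_diff g)).div (Complex.measurable_ofReal.comp (measurable_weight δ))
  · have hw : 0 ≤ dist p.1 p.2 ^ δ := Real.rpow_nonneg dist_nonneg _
    rw [norm_div, norm_mul, RCLike.norm_conj, Complex.norm_of_nonneg hw, Pi.add_apply, ← add_div]
    refine div_le_div_of_nonneg_right ?_ hw
    nlinarith [sq_nonneg (‖f p.1 - f p.2‖ - ‖g p.1 - g p.2‖), sq_nonneg ‖f p.1 - f p.2‖,
      sq_nonneg ‖g p.1 - g p.2‖]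

lemma logForm_add {f g k : Lp ℂ 2 μ} (hf : InFormDomain μ δ f) (hg : InFormDomain μ δ g)
    (hk : InFormDomain μ δ k) :
    logForm μ δ (f + g) k = logForm μ δ f k + logForm μ δ g k := by
  rw [logForm, logForm, logForm, ← mul_add,
    ← integral_add (integrable_form hf hk) (integrable_form hg hk)]
  congr 1
  refine integral_congr_ae ?_
  filter_upwards [diff_add f g] with p hp
  rw [hp, map_add]
  ring

lemma logForm_smul (c : ℂ) (f k : Lp ℂ 2 μ) :
    logForm μ δ (c • f) k = starRingEnd ℂ c * logForm μ δ f k := by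
  rw [logForm, logForm, mul_left_comm (starRingEnd ℂ c) _ _]
  congr 1
  rw [← integral_const_mul (starRingEnd ℂ c)]
  refine integral_congr_ae ?_
  filter_upwards [diff_smul c f] with p hp
  rw [hp, map_mul]
  ring

lemma logForm_zero (k : Lp ℂ 2 μ) : logForm μ δ 0 k = 0 := by
  have := logForm_smul (δ := δ) 0 0 k
  simpa using this

variable (μ δ)

/-- The graph of the operator associated with the form `𝓔_ℂ`: the pairs `(f, u)` with
`f ∈ Dom 𝓔_ℂ` and `𝓔_ℂ(f,g) = ⟪u, g⟫` for all `g ∈ Dom 𝓔_ℂ`. Equivalently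
`⟪f, g⟫ + 𝓔_ℂ(f,g) = ⟪f + u, g⟫`, that is, `f = R (f + u)` for the operator `R : L² → Dom 𝓔_ℂ`
with `⟪R v, g⟫ + 𝓔_ℂ(R v, g) = ⟪v, g⟫`, and `u = v - R v`. -/
def logLaplacianGraph : Submodule ℂ (Lp ℂ 2 μ × Lp ℂ 2 μ) where
  carrier := {p | InFormDomain μ δ p.1 ∧
    ∀ g : Lp ℂ 2 μ, InFormDomain μ δ g → logForm μ δ p.1 g = inner ℂ p.2 g}
  zero_mem' := by
    refine ⟨InFormDomain.zero δ, fun g _ => ?_⟩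
    rw [Prod.fst_zero, Prod.snd_zero, logForm_zero, inner_zero_left]
  add_mem' := by
    rintro p q ⟨hp, hp'⟩ ⟨hq, hq'⟩
    refine ⟨hp.add hq, fun g hg => ?_⟩
    rw [Prod.fst_add, Prod.snd_add, logForm_add hp hq hg, hp' g hg, hq' g hg, inner_add_left]
  smul_mem' := by
    rintro c p ⟨hp, hp'⟩
    refine ⟨hp.smul c, fun g hg => ?_⟩
    rw [Prod.smul_fst, Prod.smul_snd, logForm_smul, hp' g hg, inner_smul_left]

/-- The complex logarithmic Dirichlet Laplacian `Δ_ℂ`, the operator with the graph above (a graph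
indeed when `Dom 𝓔_ℂ` is dense in `L²_ℂ(X,μ)`, as it is in the Ahlfors `δ`-regular case). -/
def logLaplacian : Lp ℂ 2 μ →ₗ.[ℂ] Lp ℂ 2 μ :=
  (logLaplacianGraph μ δ).toLinearPMap

end Form

end LogLaplacian

end

/-! Let `W` be the form domain with norm `‖f‖² + 𝓔(f,f)`, realised in `formGraph` as the closed
graph of a weighted difference operator, and let `J : W → L²` be the inclusion. The weak definition
of `Δ` says exactly that `f = J J* (f + Δ f)` (`mem_graph_logLaplacian_iff_resolvent`), so `J J* =
(1 + Δ)⁻¹`. Since `J` is contractive with dense range, compactness of `J` yields an eigenbasis in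
which `Δ` is multiplication by numbers `a i ≥ 0` (`isDiagonal_of_graph`). Self-adjointness, `|Δ| =
Δ`, the heat semigroup and its trace are then read off in coordinates.

Compactness and summability both come from one estimate, `exists_gap`: orthogonality to at most `A
B^k` suitable vectors forces `(c k - C) ‖f‖² ≤ 𝓔(f,f)`. The vectors are indicators of the cells of a
partition of mesh `diam X / 2^k`, whose number is bounded by packing. Up to a constant, `d^{-δ}`
dominates a sum of bumps at `k` dyadic scales. By lower regularity every scale contributes a fixed
amount to the diagonal part of the truncated form, which thus grows like `k`. In the cross term,
vanishing means on the cells leave only the oscillation of the kernel within a cell; the ratios of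
mesh to scale form a geometric series, so upper regularity and the Schur test bound this term
independently of `k`. By a min-max argument (`HasLogGap.card_le`) the eigenvalue counting function
grows at most exponentially, and `∑ exp (-t a i)` converges for a suitable `t`.

The commutator `[Δ, m_h]` is the integral operator with kernel `(h x - h y) / d(x,y)^δ`. The Dini
condition, summed over dyadic annuli, bounds the integral of the absolute value of this kernel in
one variable uniformly in the other (`exists_lintegral_dini_le`), so the Schur test gives a bounded
operator (`exists_commutator`). The product rule `logForm_mulOp` identifies it with the commutator
and shows that `m_h` preserves `Dom Δ`. -/

noncomputable section

namespace LogLaplacian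

open MeasureTheory Filter Topology
open scoped ENNReal

/-! ### Unbounded diagonal operators in a Hilbert basis. -/

section Diagonal

variable {H : Type*} [NormedAddCommGroup H] [InnerProductSpace ℂ H] {ι : Type*}

/-- `D` is the maximal operator acting as multiplication by `a i` on the `i`-th vector of the
Hilbert basis `b`. -/
def IsDiagonal (D : H →ₗ.[ℂ] H) (b : HilbertBasis ι ℂ H) (a : ι → ℝ) : Prop :=
  ∀ x y : H, (x, y) ∈ D.graph ↔ ∀ i, b.repr y i = a i * b.repr x i

lemma repr_ext (b : HilbertBasis ι ℂ H) {x y : H} (h : ∀ i, b.repr x i = b.repr y i) : x = y := by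
  apply b.repr.injective
  ext i
  exact h i

lemma repr_basis (b : HilbertBasis ι ℂ H) [DecidableEq ι] (i j : ι) :
    b.repr (b i) j = if i = j then 1 else 0 := by
  rw [b.repr_apply_apply]
  have := (orthonormal_iff_ite.1 b.orthonormal) j i
  rw [this]
  simp [eq_comm]

lemma hasSum_norm_sq_repr (b : HilbertBasis ι ℂ H) (x : H) :
    HasSum (fun i => ‖b.repr x i‖ ^ 2) (‖x‖ ^ 2) := by
  have := lp.hasSum_norm (p := 2) (by norm_num) (b.repr x)
  simpa [LinearIsometryEquiv.norm_map] using this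

lemma hasSum_repr_inner (b : HilbertBasis ι ℂ H) (x y : H) :
    HasSum (fun i => starRingEnd ℂ (b.repr x i) * b.repr y i) (inner ℂ x y) := by
  have := b.hasSum_inner_mul_inner x y
  refine this.congr_fun fun i => ?_
  rw [b.repr_apply_apply, b.repr_apply_apply, inner_conj_symm]

/-- Dominated convergence for the coordinates in a Hilbert basis. -/
lemma tendsto_of_tendsto_repr (b : HilbertBasis ι ℂ H) {α : Type*} {l : Filter α}
    {u : α → H} {y : H} {g : ι → ℝ} (hg : Summable fun i => g i ^ 2)
    (hu : ∀ᶠ t in l, ∀ i, ‖b.repr (u t) i - b.repr y i‖ ≤ g i)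
    (h : ∀ i, Tendsto (fun t => b.repr (u t) i) l (𝓝 (b.repr y i))) :
    Tendsto u l (𝓝 y) := by
  rw [tendsto_iff_norm_sub_tendsto_zero]
  have key : Tendsto (fun t => ∑' i, ‖b.repr (u t) i - b.repr y i‖ ^ 2) l (𝓝 (∑' _ : ι, (0 : ℝ))) := by
    refine tendsto_tsum_of_dominated_convergence hg (fun i => ?_) ?_
    · have := ((h i).sub_const (b.repr y i)).norm.pow 2
      simpa using this
    · filter_upwards [hu] with t ht i
      rw [Real.norm_of_nonneg (by positivity)]
      have := ht i
      gcongr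
  have e : ∀ t, ∑' i, ‖b.repr (u t) i - b.repr y i‖ ^ 2 = ‖u t - y‖ ^ 2 := fun t => by
    rw [← (hasSum_norm_sq_repr b (u t - y)).tsum_eq]
    simp
  simp only [e, tsum_zero] at key
  have := key.sqrt
  simpa using this

/-- Bounded diagonal operators. -/
lemma exists_diagonal_clm (b : HilbertBasis ι ℂ H) (a : ι → ℝ) (ha : ∀ i, |a i| ≤ 1) :
    ∃ T : H →L[ℂ] H, ∀ x i, b.repr (T x) i = a i * b.repr x i := by
  have hb : ∀ (f : lp (fun _ : ι => ℂ) 2) i, ‖(a i : ℂ) * f i‖ ≤ ‖f i‖ := fun f i => by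
    rw [norm_mul, Complex.norm_real]
    exact mul_le_of_le_one_left (norm_nonneg _) (ha i)
  have hm : ∀ f : lp (fun _ : ι => ℂ) 2, Memℓp (fun i => (a i : ℂ) * f i) 2 := fun f => by
    have hf := lp.memℓp f
    rw [memℓp_gen_iff (by norm_num)] at hf ⊢
    refine Summable.of_nonneg_of_le (fun i => by positivity) (fun i => ?_) hf
    exact Real.rpow_le_rpow (norm_nonneg _) (hb f i) (by norm_num)
  let M : lp (fun _ : ι => ℂ) 2 →ₗ[ℂ] lp (fun _ : ι => ℂ) 2 :=
    { toFun := fun f => ⟨fun i => (a i : ℂ) * f i, hm f⟩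
      map_add' := fun f g => by
        ext i
        simp only [lp.coeFn_add, Pi.add_apply]
        exact mul_add _ _ _
      map_smul' := fun c f => by
        ext i
        simp only [lp.coeFn_smul, Pi.smul_apply, smul_eq_mul, RingHom.id_apply]
        exact mul_left_comm _ _ _ }
  have hM : ∀ f, ‖M f‖ ≤ 1 * ‖f‖ := fun f => by
    rw [one_mul]
    refine lp.norm_le_of_forall_sum_le (p := 2) (by norm_num) (norm_nonneg _) fun s => ?_
    refine (Finset.sum_le_sum fun i _ => ?_).trans
      (lp.sum_rpow_le_norm_rpow (p := 2) (by norm_num) f s)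
    exact Real.rpow_le_rpow (norm_nonneg _) (hb f i) (by norm_num)
  let M' := M.mkContinuous 1 hM
  refine ⟨(b.repr.symm : lp (fun _ : ι => ℂ) 2 →L[ℂ] H) ∘L M' ∘L (b.repr : H →L[ℂ] _),
    fun x i => ?_⟩
  simp [M', M]

namespace IsDiagonal

variable {D : H →ₗ.[ℂ] H} {b : HilbertBasis ι ℂ H} {a : ι → ℝ} (hD : IsDiagonal D b a)
include hD

lemma basis_mem (i : ι) : (b i, (a i : ℂ) • b i) ∈ D.graph := by
  classical
  refine (hD _ _).2 fun j => ?_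
  rw [map_smul, lp.coeFn_smul, Pi.smul_apply, smul_eq_mul, repr_basis]
  split_ifs with h
  · rw [h]
  · simp

lemma dense_domain : Dense (D.domain : Set H) := by
  have h : Submodule.span ℂ (Set.range b) ≤ D.domain := by
    rw [Submodule.span_le]
    rintro _ ⟨i, rfl⟩
    exact LinearPMap.mem_domain_of_mem_graph (hD.basis_mem i)
  refine Dense.mono h ?_
  rw [Submodule.dense_iff_topologicalClosure_eq_top]
  exact b.dense_span

lemma apply_repr (x : D.domain) (i : ι) : b.repr (D x) i = a i * b.repr (x : H) i :=
  (hD _ _).1 (D.mem_graph x) i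

variable [CompleteSpace H]

/-- Testing the adjoint relation against `b i` forces the coordinates of `D† x` to be `a i` times
those of `x`. The converse is Parseval, `a i` being real; maximality of the domain of `D` makes the
two graphs equal. -/
lemma isSelfAdjoint : IsSelfAdjoint D := by
  rw [LinearPMap.isSelfAdjoint_def]
  refine LinearPMap.eq_of_eq_graph ?_
  ext ⟨x, y⟩
  rw [hD x y]
  constructor
  · intro h i
    obtain ⟨⟨x', hx'⟩, h1, h2⟩ := (LinearPMap.mem_graph_iff _).1 h
    simp only at h1 h2
    subst h1
    obtain ⟨z, hz1, hz2⟩ := (LinearPMap.mem_graph_iff _).1 (hD.basis_mem i)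
    have := LinearPMap.adjoint_isFormalAdjoint hD.dense_domain ⟨x', hx'⟩ z
    simp only at hz1 hz2
    rw [h2, hz1, hz2, inner_smul_right] at this
    simp only [b.repr_apply_apply]
    rw [← inner_conj_symm (b i) y, this, map_mul, inner_conj_symm, Complex.conj_ofReal]
  · intro h
    have hf : ∀ z : D.domain, inner ℂ y (z : H) = inner ℂ x (D z) := fun z => by
      rw [← (hasSum_repr_inner b y z).tsum_eq, ← (hasSum_repr_inner b x (D z)).tsum_eq]
      refine tsum_congr fun i => ?_
      rw [h i, hD.apply_repr z i, map_mul, Complex.conj_ofReal]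
      ring
    have hx := D.mem_adjoint_domain_of_exists x ⟨y, hf⟩
    refine (LinearPMap.mem_graph_iff _).2 ⟨⟨x, hx⟩, rfl, ?_⟩
    exact LinearPMap.adjoint_apply_eq hD.dense_domain _ hf

lemma isAbsoluteValue (ha : ∀ i, 0 ≤ a i) : IsAbsoluteValue D D where
  selfAdjoint := hD.isSelfAdjoint
  nonneg x := by
    have h := Complex.reCLM.hasSum (hasSum_repr_inner b x (D x))
    refine h.nonneg fun i => ?_
    have e : starRingEnd ℂ (b.repr (x : H) i) * b.repr (D x) i
        = ((a i * ‖b.repr (x : H) i‖ ^ 2 : ℝ) : ℂ) := by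
      rw [hD.apply_repr, mul_left_comm, Complex.conj_mul']
      push_cast
      rfl
    simp only [e]
    exact mul_nonneg (ha i) (sq_nonneg _)
  sq_eq x y := by
    rw [LinearPMap.isSelfAdjoint_def.1 hD.isSelfAdjoint]

-- Every axiom is checked coordinatewise. Passing from coordinates to norm limits is dominated
-- convergence, which needs `a i ≥ 0`.
omit [CompleteSpace H] in
lemma isHeatSemigroup (ha : ∀ i, 0 ≤ a i) {S : ℝ → H →L[ℂ] H}
    (hS : ∀ t, 0 ≤ t → ∀ x i, b.repr (S t x) i = (Real.exp (-t * a i) : ℝ) * b.repr x i) :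
    IsHeatSemigroup D S where
  map_zero := by
    ext x
    refine repr_ext b fun i => ?_
    rw [hS 0 le_rfl]
    simp
  map_add s t hs ht := by
    ext x
    refine repr_ext b fun i => ?_
    rw [hS _ (add_nonneg hs ht), mul_apply_eq_comp, hS s hs, hS t ht, ← mul_assoc,
      ← Complex.ofReal_mul, ← Real.exp_add]
    congr 4
    ring
  strongly_continuous x := by
    have hx := (hasSum_norm_sq_repr b x).summable
    refine tendsto_of_tendsto_repr b hx ?_ fun i => ?_
    · filter_upwards [self_mem_nhdsWithin] with t ht i
      have ht' : 0 ≤ t := le_of_lt ht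
      rw [hS t ht', ← sub_one_mul, norm_mul]
      refine mul_le_of_le_one_left (norm_nonneg _) ?_
      rw [← Complex.ofReal_one, ← Complex.ofReal_sub, Complex.norm_real, Real.norm_eq_abs,
        abs_le]
      have h1 := Real.exp_pos (-t * a i)
      have h2 : Real.exp (-t * a i) ≤ 1 := Real.exp_le_one_iff.2 (by nlinarith [ha i])
      constructor <;> linarith
    · have h1 : Tendsto (fun t : ℝ => ((Real.exp (-t * a i) : ℝ) : ℂ) * b.repr x i) (𝓝[>] 0)
          (𝓝 (((Real.exp (-0 * a i) : ℝ) : ℂ) * b.repr x i)) := by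
        refine Tendsto.mono_left (Continuous.tendsto ?_ 0) nhdsWithin_le_nhds
        fun_prop
      simp only [neg_zero, zero_mul, Real.exp_zero, Complex.ofReal_one, one_mul] at h1
      refine h1.congr' ?_
      filter_upwards [self_mem_nhdsWithin] with t ht
      rw [hS t (le_of_lt ht)]
  generator x y := by
    have hq : ∀ t, 0 ≤ t → ∀ i, b.repr (((t⁻¹ : ℝ) : ℂ) • (S t x - x)) i
        = ((t⁻¹ * (Real.exp (-t * a i) - 1) : ℝ) : ℂ) * b.repr x i := fun t ht i => by
      rw [map_smul, map_sub, lp.coeFn_smul, Pi.smul_apply, lp.coeFn_sub, Pi.sub_apply, hS t ht,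
        smul_eq_mul]
      push_cast
      ring
    have hl : ∀ i, Tendsto (fun t : ℝ => b.repr (((t⁻¹ : ℝ) : ℂ) • (S t x - x)) i) (𝓝[>] 0)
        (𝓝 (-(a i : ℂ) * b.repr x i)) := fun i => by
      have h0 : HasDerivAt (fun t : ℝ => Real.exp (-t * a i)) (-a i) 0 := by
        have := (((hasDerivAt_id (0 : ℝ)).neg).mul_const (a i)).exp
        simpa using this
      have h1 := h0.tendsto_slope_zero_right
      simp only [zero_add, neg_zero, zero_mul, Real.exp_zero, smul_eq_mul] at h1
      have h2 := ((Complex.continuous_ofReal.tendsto _).comp h1).mul_const (b.repr x i)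
      rw [Complex.ofReal_neg] at h2
      refine h2.congr' ?_
      filter_upwards [self_mem_nhdsWithin] with t ht
      rw [hq t (le_of_lt ht)]
      rfl
    have hneg : (x, y) ∈ (-D).graph ↔ (x, -y) ∈ D.graph := by
      simp only [LinearPMap.mem_graph_iff, LinearPMap.neg_domain, LinearPMap.neg_apply]
      constructor
      · rintro ⟨z, h1, h2⟩
        exact ⟨z, h1, by rw [← h2]; exact (neg_neg _).symm⟩
      · rintro ⟨z, h1, h2⟩
        exact ⟨z, h1, by rw [h2]; exact neg_neg _⟩
    rw [hneg, hD]
    constructor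
    · intro h
      have hy : ∀ i, b.repr y i = -(a i : ℂ) * b.repr x i := fun i => by
        have := h i
        rw [map_neg, lp.coeFn_neg, Pi.neg_apply] at this
        rw [neg_mul, ← this, neg_neg]
      -- The dominating sequence: `1 - s ≤ exp (-s)` bounds the difference quotient by `a i ‖x_i‖ =
      -- ‖y_i‖`, and its limit contributes another `‖y_i‖`.
      have hg : Summable fun i => (2 * ‖b.repr y i‖) ^ 2 := by
        simp only [mul_pow]
        exact (hasSum_norm_sq_repr b y).summable.mul_left _
      refine tendsto_of_tendsto_repr b hg ?_ fun i => ?_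
      · filter_upwards [self_mem_nhdsWithin] with t ht i
        have ht' : 0 < t := ht
        refine (norm_sub_le _ _).trans ?_
        rw [two_mul]
        refine add_le_add_left ?_ _
        rw [hq t ht'.le, hy, norm_mul, norm_mul, norm_neg, Complex.norm_real, Complex.norm_real]
        refine mul_le_mul_of_nonneg_right ?_ (norm_nonneg _)
        have h1 : Real.exp (-t * a i) ≤ 1 := Real.exp_le_one_iff.2 (by nlinarith [ha i])
        have h2 := Real.add_one_le_exp (-t * a i)
        rw [norm_mul, norm_inv, Real.norm_of_nonneg ht'.le, Real.norm_of_nonpos (by linarith),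
          Real.norm_of_nonneg (ha i), inv_mul_le_iff₀ ht']
        linarith
      · rw [hy]
        exact hl i
    -- Norm convergence implies convergence of coordinates, whose limits are known; no domination is
    -- needed.
    · intro h i
      have h1 : Tendsto (fun t : ℝ => b.repr (((t⁻¹ : ℝ) : ℂ) • (S t x - x)) i) (𝓝[>] 0)
          (𝓝 (b.repr y i)) := by
        simp only [b.repr_apply_apply]
        exact tendsto_const_nhds.inner h
      rw [map_neg, lp.coeFn_neg, Pi.neg_apply, tendsto_nhds_unique h1 (hl i), neg_mul, neg_neg]

end IsDiagonal

lemma isTraceClass_of_diagonal [CompleteSpace H] {w : Set H} (b : HilbertBasis w ℂ H)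
    {a : w → ℝ} {T : H →L[ℂ] H} (hT : ∀ x i, b.repr (T x) i = a i * b.repr x i)
    (ha : ∀ i, 0 ≤ a i) (hs : Summable a) : IsTraceClass T := by
  classical
  have hpos : 0 ≤ T := by
    rw [ContinuousLinearMap.nonneg_iff_isPositive]
    constructor
    · intro x y
      rw [ContinuousLinearMap.coe_coe, ← (hasSum_repr_inner b (T x) y).tsum_eq,
        ← (hasSum_repr_inner b x (T y)).tsum_eq]
      refine tsum_congr fun i => ?_
      rw [hT, hT, map_mul, Complex.conj_ofReal]
      ring
    · intro x
      have h := Complex.reCLM.hasSum (hasSum_repr_inner b (T x) x)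
      refine h.nonneg fun i => ?_
      have e : starRingEnd ℂ (b.repr (T x) i) * b.repr x i
          = ((a i * ‖b.repr (x : H) i‖ ^ 2 : ℝ) : ℂ) := by
        rw [hT, map_mul, mul_assoc, Complex.conj_mul', Complex.conj_ofReal]
        push_cast
        rfl
      simp only [e]
      exact mul_nonneg (ha i) (sq_nonneg _)
  refine ⟨w, b, ?_⟩
  rw [CFC.abs_of_nonneg T hpos]
  refine hs.congr fun i => ?_
  rw [← b.repr_apply_apply, hT, repr_basis]
  simp

end Diagonal

/-! ### Spectral theorem for compact symmetric operators. -/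

section Eigenbasis

variable {H : Type*} [NormedAddCommGroup H] [InnerProductSpace ℂ H] [CompleteSpace H]

/-- Distinct eigenspaces are orthogonal and together total, so Hilbert bases of the eigenspaces
glue. The basis is indexed by its own range because `IsTraceClass` asks for a set of vectors as
index type. -/
lemma exists_hilbertBasis_eigenvectors {T : H →L[ℂ] H} (hT : IsCompactOperator T)
    (hs : (T : H →ₗ[ℂ] H).IsSymmetric) :
    ∃ (w : Set H) (b : HilbertBasis w ℂ H) (μ : w → ℂ), ∀ i, T (b i) = μ i • b i := by
  choose s bs hbs using fun μ : ℂ =>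
    exists_hilbertBasis ℂ (Module.End.eigenspace (T : H →ₗ[ℂ] H) μ)
  let v : (Σ μ, s μ) → H := fun a => (bs a.1 a.2 : H)
  have hv : Orthonormal ℂ v :=
    hs.orthogonalFamily_eigenspaces.orthonormal_sigma_orthonormal
      (v_family := fun μ i => bs μ i) fun μ => (bs μ).orthonormal
  have hbot : (Submodule.span ℂ (Set.range ((↑) : Set.range v → H)))ᗮ = ⊥ := by
    rw [Subtype.range_coe, eq_bot_iff,
      ← ContinuousLinearMap.orthogonalComplement_iSup_eigenspaces_eq_bot hT hs]
    intro x hx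
    -- A vector orthogonal to the chosen basis of an eigenspace is orthogonal to all of it, the
    -- kernel of a continuous functional being closed.
    have hle : ⨆ μ, Module.End.eigenspace (T : H →ₗ[ℂ] H) μ ≤ (ℂ ∙ x)ᗮ := by
      refine iSup_le fun μ e he => ?_
      rw [Submodule.mem_orthogonal_singleton_iff_inner_right]
      let φ := innerSL ℂ x ∘L (Module.End.eigenspace (T : H →ₗ[ℂ] H) μ).subtypeL
      have hφ : Submodule.span ℂ (Set.range (bs μ)) ≤ φ.ker := by
        rw [Submodule.span_le]
        rintro _ ⟨i, rfl⟩
        exact (Submodule.mem_orthogonal' _ _).1 hx _ (Submodule.subset_span ⟨⟨μ, i⟩, rfl⟩)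
      have := Submodule.topologicalClosure_minimal _ hφ φ.isClosed_ker
      rw [(bs μ).dense_span] at this
      exact this (Submodule.mem_top (x := ⟨e, he⟩))
    rw [Submodule.mem_orthogonal']
    exact fun e he => (Submodule.mem_orthogonal_singleton_iff_inner_right).1 (hle he)
  refine ⟨Set.range v, HilbertBasis.mkOfOrthogonalEqBot hv.toSubtypeRange hbot, ?_⟩
  rw [HilbertBasis.coe_mkOfOrthogonalEqBot]
  have : ∀ i : Set.range v, ∃ μ : ℂ, T i = μ • (i : H) := by
    rintro ⟨_, a, rfl⟩
    exact ⟨a.1, Module.End.mem_eigenspace_iff.1 (bs a.1 a.2).2⟩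
  choose μ hμ using this
  exact ⟨μ, hμ⟩

end Eigenbasis

/-! ### Spectral theory of the operator attached to a form embedding. -/

section FormOperator

variable {H W : Type*} [NormedAddCommGroup H] [InnerProductSpace ℂ H] [CompleteSpace H]
  [NormedAddCommGroup W] [InnerProductSpace ℂ W] [CompleteSpace W]

/-- A quantitative form of the compactness of `J`: the inclusion `J` of the form domain is small
on the orthogonal complements of subspaces of exponentially growing dimension. -/
def HasLogGap (J : W →L[ℂ] H) (A B c C : ℝ) : Prop :=
  ∀ k : ℕ, ∃ N : ℕ, (N : ℝ) ≤ A * B ^ k ∧ ∃ v : Fin N → H, ∀ w : W,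
    (∀ j, inner ℂ (v j) (J w) = 0) → (c * k - C) * ‖J w‖ ^ 2 ≤ ‖w‖ ^ 2

/-- With `P_k` the projection onto the span of the vectors `J* v_j`, the gap gives `‖J - J P_k‖ ≤ (c
k - C)^{-1/2}`. Thus `J` is a norm limit of finite rank operators. -/
lemma HasLogGap.isCompactOperator {J : W →L[ℂ] H} {A B c C : ℝ} (hc : 0 < c)
    (h : HasLogGap J A B c C) : IsCompactOperator J := by
  choose N _ v hv using h
  let V : ℕ → Submodule ℂ W := fun k =>
    Submodule.span ℂ (Set.range fun j => ContinuousLinearMap.adjoint J (v k j))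
  have hfin : ∀ k, FiniteDimensional ℂ (V k) := fun k =>
    FiniteDimensional.span_of_finite ℂ (Set.finite_range _)
  let F : ℕ → W →L[ℂ] H := fun k => J ∘L (V k).starProjection
  have hlim : Tendsto (fun k : ℕ => c * (k : ℝ) - C) atTop atTop :=
    tendsto_atTop_add_const_right _ _ (tendsto_natCast_atTop_atTop.const_mul_atTop hc)
  have hF : Tendsto F atTop (𝓝 J) := by
    rw [tendsto_iff_norm_sub_tendsto_zero]
    have h0 : Tendsto (fun k : ℕ => √((c * (k : ℝ) - C)⁻¹)) atTop (𝓝 0) := by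
      simpa using (hlim.inv_tendsto_atTop).sqrt
    refine squeeze_zero' (Eventually.of_forall fun k => norm_nonneg _) ?_ h0
    filter_upwards [hlim.eventually_gt_atTop 0] with k hk
    refine ContinuousLinearMap.opNorm_le_bound _ (Real.sqrt_nonneg _) fun w => ?_
    set z := w - (V k).starProjection w with hz
    have hzV : z ∈ (V k)ᗮ := Submodule.sub_starProjection_mem_orthogonal w
    have hzn : ‖z‖ ≤ ‖w‖ := by
      have := Submodule.norm_sq_eq_add_norm_sq_starProjection w (V k)
      rw [Submodule.starProjection_orthogonal_val] at this
      have h2 : ‖z‖ ^ 2 ≤ ‖w‖ ^ 2 := by rw [this]; nlinarith [sq_nonneg ‖(V k).starProjection w‖]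
      exact (sq_le_sq₀ (norm_nonneg _) (norm_nonneg _)).1 h2
    have hJ := hv k z fun j => by
      rw [← ContinuousLinearMap.adjoint_inner_left]
      exact (Submodule.mem_orthogonal _ _).1 hzV _ (Submodule.subset_span ⟨j, rfl⟩)
    have e : (F k - J) w = -J z := by simp [F, hz]
    rw [e, norm_neg, ← Real.sqrt_sq (norm_nonneg w), ← Real.sqrt_mul (by positivity)]
    refine Real.le_sqrt_of_sq_le ?_
    rw [inv_mul_eq_div, le_div_iff₀' hk]
    exact hJ.trans (by gcongr)
  refine isCompactOperator_of_tendsto hF (Eventually.of_forall fun k => ?_)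
  have : ProperSpace (V k) := FiniteDimensional.proper ℂ (V k)
  have h1 : IsCompactOperator (V k).subtypeL :=
    isCompactOperator_of_locallyCompactSpace_rng (V k).subtypeL
  exact (h1.comp_clm (V k).orthogonalProjectionOnto).clm_comp J

variable {J : W →L[ℂ] H}

/-- The graph condition says `J J* = (1 + D)⁻¹`. An eigenvector `b i` of the compact operator `J J*`
has eigenvalue `m = ‖J* (b i)‖²`, which lies in `(0, 1]`: `J*` is injective because `J` has dense
range, and `J` is a contraction. Hence `a i = m⁻¹ - 1 ≥ 0`. -/
lemma isDiagonal_of_graph {D : H →ₗ.[ℂ] H} (hJ : IsCompactOperator J)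
    (hdense : DenseRange J) (hle : ∀ w, ‖J w‖ ≤ ‖w‖)
    (hD : ∀ x y, (x, y) ∈ D.graph ↔ x = J (ContinuousLinearMap.adjoint J (x + y))) :
    ∃ (s : Set H) (b : HilbertBasis s ℂ H) (a : s → ℝ), (∀ i, 0 ≤ a i) ∧ IsDiagonal D b a ∧
      ∀ x i, b.repr (J (ContinuousLinearMap.adjoint J x)) i
        = ((1 + a i : ℝ) : ℂ)⁻¹ * b.repr x i := by
  set J' := ContinuousLinearMap.adjoint J with hJ'
  have hsym : ((J ∘L J' : H →L[ℂ] H) : H →ₗ[ℂ] H).IsSymmetric := fun x y => by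
    simp only [ContinuousLinearMap.coe_coe, ContinuousLinearMap.comp_apply]
    rw [← ContinuousLinearMap.adjoint_inner_left J, ← ContinuousLinearMap.adjoint_inner_right J]
  obtain ⟨s, b, μ, hb⟩ := exists_hilbertBasis_eigenvectors (hJ.comp_clm J' : IsCompactOperator (J ∘L J')) hsym
  have hJ'inj : ∀ x, J' x = 0 → x = 0 := fun x hx => by
    refine hdense.eq_zero_of_inner_left ℂ fun w => ?_
    rw [← ContinuousLinearMap.adjoint_inner_left, ← hJ', hx, inner_zero_left]
  have hμ : ∀ i, μ i = ((‖J' (b i)‖ ^ 2 : ℝ) : ℂ) := fun i => by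
    have h1 : inner ℂ (b i) (J (J' (b i))) = μ i := by
      have := hb i
      rw [ContinuousLinearMap.comp_apply] at this
      rw [this, inner_smul_right, inner_self_eq_norm_sq_to_K, b.orthonormal.1 i]
      simp
    rw [← h1, ← ContinuousLinearMap.adjoint_inner_left, inner_self_eq_norm_sq_to_K]
    simp [hJ']
  have hpos : ∀ i, 0 < ‖J' (b i)‖ := fun i => norm_pos_iff.2 fun h => by
    have := b.orthonormal.1 i
    rw [hJ'inj _ h, norm_zero] at this
    exact zero_ne_one this
  have hle1 : ∀ i, ‖J' (b i)‖ ≤ 1 := fun i => by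
    refine (J'.le_opNorm _).trans ?_
    rw [b.orthonormal.1 i, mul_one, hJ', LinearIsometryEquiv.norm_map]
    exact J.opNorm_le_bound zero_le_one (by simpa using hle)
  have hrepr : ∀ x i, b.repr (J (J' x)) i = ((‖J' (b i)‖ ^ 2 : ℝ) : ℂ) * b.repr x i := fun x i => by
    rw [b.repr_apply_apply, b.repr_apply_apply]
    have := hsym (b i) x
    simp only [ContinuousLinearMap.coe_coe] at this
    rw [← ContinuousLinearMap.comp_apply, ← this, hb, inner_smul_left, hμ, Complex.conj_ofReal]
  refine ⟨s, b, fun i => (‖J' (b i)‖ ^ 2)⁻¹ - 1, fun i => ?_, fun x y => ?_, fun x i => ?_⟩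
  · rw [sub_nonneg]
    exact (one_le_inv₀ (pow_pos (hpos i) 2)).2 (pow_le_one₀ (norm_nonneg _) (hle1 i))
  · rw [hD]
    have hne : ∀ i, ((‖J' (b i)‖ ^ 2 : ℝ) : ℂ) ≠ 0 := fun i => by
      exact_mod_cast (pow_pos (hpos i) 2).ne'
    have key : ∀ i, b.repr x i = b.repr (J (J' (x + y))) i ↔
        b.repr y i = (((‖J' (b i)‖ ^ 2)⁻¹ - 1 : ℝ) : ℂ) * b.repr x i := fun i => by
      rw [hrepr, map_add, lp.coeFn_add, Pi.add_apply, Complex.ofReal_sub, Complex.ofReal_inv,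
        Complex.ofReal_one]
      have := hne i
      generalize ((‖J' (b i)‖ ^ 2 : ℝ) : ℂ) = m at *
      generalize b.repr x i = p
      generalize b.repr y i = q
      constructor
      · intro h
        field_simp
        linear_combination -h
      · intro h
        rw [h]
        field_simp
        ring
    constructor
    · intro h i
      rw [← key i, ← h]
    · intro h
      exact repr_ext b fun i => (key i).2 (h i)
  · rw [hrepr]
    simp

/-- Min-max: were there more than `N` such eigenvalues, some nonzero `x` in the span of their
eigenvectors would satisfy the `N` orthogonality conditions. Its form norm squared would be at most
`M ‖x‖²`, against the gap. -/
lemma HasLogGap.card_le {A B c C : ℝ} (h : HasLogGap J A B c C) {ι : Type*}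
    {b : HilbertBasis ι ℂ H} {a : ι → ℝ} (ha : ∀ i, 0 ≤ a i)
    (hb : ∀ x i, b.repr (J (ContinuousLinearMap.adjoint J x)) i
        = ((1 + a i : ℝ) : ℂ)⁻¹ * b.repr x i)
    (k : ℕ) {M : ℝ} (hM : M < c * k - C) (s : Finset ι) (hs : ∀ i ∈ s, 1 + a i ≤ M) :
    (s.card : ℝ) ≤ A * B ^ k := by
  classical
  obtain ⟨N, hN, v, hv⟩ := h k
  refine le_trans ?_ hN
  by_contra hlt
  have hlt' : N < s.card := by exact_mod_cast not_le.1 hlt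
  let P : (s → ℂ) →ₗ[ℂ] H := Fintype.linearCombination ℂ (fun i : s => b i)
  let f : (s → ℂ) →ₗ[ℂ] (Fin N → ℂ) := LinearMap.pi fun j => (innerSL ℂ (v j)).toLinearMap ∘ₗ P
  have hker : f.ker ≠ ⊥ := LinearMap.ker_ne_bot_of_finrank_lt (by simpa using hlt')
  obtain ⟨z, hz, hz0⟩ := (Submodule.ne_bot_iff _).1 hker
  have hPr : ∀ (z : s → ℂ) i, b.repr (P z) i = if hi : i ∈ s then z ⟨i, hi⟩ else 0 := fun z i => by
    simp only [P, Fintype.linearCombination_apply, map_sum, map_smul]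
    rw [lp.coeFn_sum, Finset.sum_apply]
    simp only [lp.coeFn_smul, Pi.smul_apply, repr_basis, smul_eq_mul, mul_ite, mul_one, mul_zero]
    split_ifs with hi
    · rw [Finset.sum_eq_single ⟨i, hi⟩]
      · simp
      · intro j _ hj
        rw [if_neg]
        rintro rfl
        exact hj rfl
      · simp
    · refine Finset.sum_eq_zero fun j _ => ?_
      rw [if_neg]
      rintro rfl
      exact hi j.2
  set x := P z with hx
  -- `u` plays the role of `(1 + D) x`, so that `J* u` is the element of `W` lying over `x`.
  set u := P fun i => ((1 + a i : ℝ) : ℂ) * z i with hu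
  have hux : ∀ i, b.repr u i = ((1 + a i : ℝ) : ℂ) * b.repr x i := fun i => by
    rw [hu, hx, hPr, hPr]
    split_ifs <;> simp
  have hJu : J (ContinuousLinearMap.adjoint J u) = x := repr_ext b fun i => by
    have : ((1 + a i : ℝ) : ℂ) ≠ 0 := by
      have := ha i
      exact_mod_cast (by positivity : (1 + a i) ≠ 0)
    rw [hb, hux, inv_mul_cancel_left₀ this]
  have h1 := hv (ContinuousLinearMap.adjoint J u) fun j => by
    rw [hJu]
    exact congrFun hz j
  rw [hJu] at h1
  have h2 : HasSum (fun i => (1 + a i) * ‖b.repr x i‖ ^ 2) (‖ContinuousLinearMap.adjoint J u‖ ^ 2) := by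
    have h3 := Complex.reCLM.hasSum (hasSum_repr_inner b u x)
    have h4 : Complex.reCLM (inner ℂ u x) = ‖ContinuousLinearMap.adjoint J u‖ ^ 2 := by
      rw [← hJu, ← ContinuousLinearMap.adjoint_inner_left, inner_self_eq_norm_sq_to_K]
      simp [← Complex.ofReal_pow]
    rw [h4] at h3
    refine h3.congr_fun fun i => ?_
    simp only [hux, map_mul, Complex.conj_ofReal]
    rw [mul_assoc, Complex.conj_mul']
    simp [← Complex.ofReal_pow, -Complex.ofReal_add]
  have h5 : ‖ContinuousLinearMap.adjoint J u‖ ^ 2 ≤ M * ‖x‖ ^ 2 := by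
    refine hasSum_le (fun i => ?_) h2 ((hasSum_norm_sq_repr b x).mul_left M)
    by_cases hi : i ∈ s
    · have := hs i hi
      gcongr
    · rw [hx, hPr, dif_neg hi]
      simp
  have hx0 : 0 < ‖x‖ ^ 2 := by
    refine pow_pos (norm_pos_iff.2 fun h0 => hz0 ?_) 2
    ext i
    have := hPr z i
    rw [← hx, h0, dif_pos i.2] at this
    simpa using this.symm
  nlinarith

/-- Grouping the eigenvalues into bands of width `c` puts at most `A B^{k+1}` of them in the `k`-th
band, where `exp (-t a)` is of order `exp (-t c k)`. -/
lemma HasLogGap.exists_summable {A B c C : ℝ} (hc : 0 < c) (hC : 0 ≤ C) (hA : 0 ≤ A) (hB : 1 ≤ B)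
    (h : HasLogGap J A B c C) {ι : Type*}
    {b : HilbertBasis ι ℂ H} {a : ι → ℝ} (ha : ∀ i, 0 ≤ a i)
    (hb : ∀ x i, b.repr (J (ContinuousLinearMap.adjoint J x)) i
        = ((1 + a i : ℝ) : ℂ)⁻¹ * b.repr x i) :
    ∃ t : ℝ, 0 < t ∧ Summable fun i => Real.exp (-t * a i) := by
  classical
  have hB0 : 0 < B := by linarith
  have hlog : 0 < Real.log (2 * B) := Real.log_pos (by linarith)
  -- Chosen so that `exp (-t c) = 1 / (2 B)`: the decay beats the multiplicity `B^k` by `2^{-k}`.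
  set t := Real.log (2 * B) / c with ht
  have ht0 : 0 < t := by positivity
  have hq : Real.exp (-t * c) = (2 * B)⁻¹ := by
    rw [ht, neg_mul, div_mul_cancel₀ _ hc.ne', Real.exp_neg, Real.exp_log (by positivity)]
  refine ⟨t, ht0, ?_⟩
  let κ : ι → ℕ := fun i => ⌈(1 + a i + C) / c⌉₊
  have hκ1 : ∀ i, 1 + a i ≤ c * κ i - C := fun i => by
    have := Nat.le_ceil ((1 + a i + C) / c)
    rw [div_le_iff₀' hc] at this
    change 1 + a i ≤ c * (⌈(1 + a i + C) / c⌉₊ : ℝ) - C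
    linarith
  have hκ2 : ∀ i, c * κ i - (c + 1 + C) ≤ a i := fun i => by
    have h0 : 0 ≤ (1 + a i + C) / c := div_nonneg (by linarith [ha i]) hc.le
    have := Nat.ceil_lt_add_one h0
    rw [← sub_lt_iff_lt_add, lt_div_iff₀' hc] at this
    change c * (⌈(1 + a i + C) / c⌉₊ : ℝ) - (c + 1 + C) ≤ a i
    linarith
  have hsum : Summable fun i => (2 * B)⁻¹ ^ κ i := by
    refine summable_of_sum_le (c := A * B * 2) (fun i => by positivity) fun s => ?_
    rw [Finset.sum_comp (fun k : ℕ => (2 * B)⁻¹ ^ k) κ]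
    calc ∑ k ∈ s.image κ, (s.filter fun i => κ i = k).card • (2 * B)⁻¹ ^ k
        ≤ ∑ k ∈ s.image κ, A * B * (1 / 2) ^ k := by
          refine Finset.sum_le_sum fun k _ => ?_
          -- The level is `k + 1` because the counting bound needs `M` strictly below the gap; this
          -- costs one factor `B`.
          have hcard := h.card_le ha hb (k + 1) (M := c * k - C) (by push_cast; linarith)
            (s.filter fun i => κ i = k) fun i hi => by
              have := hκ1 i
              rwa [(Finset.mem_filter.1 hi).2] at this
          rw [nsmul_eq_mul]
          calc _ ≤ A * B ^ (k + 1) * (2 * B)⁻¹ ^ k := by gcongr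
            _ = A * B * (1 / 2) ^ k := by
              have : (2 * B)⁻¹ ^ k * B ^ k = (1 / 2) ^ k := by
                rw [← mul_pow]
                congr 1
                field_simp
              rw [← this]
              ring
      _ = A * B * ∑ k ∈ s.image κ, (1 / 2 : ℝ) ^ k := by rw [Finset.mul_sum]
      _ ≤ A * B * 2 := by
          refine mul_le_mul_of_nonneg_left ?_ (by positivity)
          exact (summable_geometric_two.sum_le_tsum _ fun _ _ => by positivity).trans_eq
            tsum_geometric_two
  refine Summable.of_nonneg_of_le (fun i => (Real.exp_pos _).le) (fun i => ?_)
    (hsum.mul_left (Real.exp (t * (c + 1 + C))))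
  rw [← hq, ← Real.exp_nat_mul, ← Real.exp_add, Real.exp_le_exp]
  nlinarith [mul_le_mul_of_nonneg_left (hκ2 i) ht0.le]

end FormOperator

/-! ### First consequences of Ahlfors regularity. -/

section Regular

variable {X : Type*} [MetricSpace X]

lemma diam_univ_pos [Nontrivial X] (hb : Bornology.IsBounded (Set.univ : Set X)) :
    0 < Metric.diam (Set.univ : Set X) := by
  obtain ⟨x, y, hxy⟩ := exists_pair_ne X
  exact (dist_pos.2 hxy).trans_le (Metric.dist_le_diam_of_mem hb (Set.mem_univ _) (Set.mem_univ _))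

variable [MeasurableSpace X] {μ : Measure X} {δ : ℝ}

/-- For infinite diameter the lower bound would hold at every radius and exceed the finite total
mass. -/
lemma IsAhlforsRegular.isBounded [IsFiniteMeasure μ] [Nonempty X]
    (h : IsAhlforsRegular μ δ) : Bornology.IsBounded (Set.univ : Set X) := by
  obtain ⟨hδ, C, hC, hr⟩ := h
  rw [Metric.isBounded_iff_ediam_ne_top]
  intro htop
  obtain ⟨x⟩ := ‹Nonempty X›
  have hlim : Tendsto (fun r : ℝ => C⁻¹ * r ^ δ) atTop atTop :=
    (tendsto_rpow_atTop hδ).const_mul_atTop (by positivity)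
  obtain ⟨r, hr1, hr0⟩ :=
    ((hlim.eventually_gt_atTop (μ.real Set.univ)).and (eventually_ge_atTop 0)).exists
  have h1 := (hr x r hr0 (by rw [htop]; exact ENNReal.ofReal_lt_top)).1.trans
    (measure_mono (Set.subset_univ _))
  rw [← ofReal_measureReal, ENNReal.ofReal_le_ofReal_iff measureReal_nonneg] at h1
  linarith

/-- The upper bound extends to radii beyond the diameter by enlarging the constant to at least `μ X
/ (diam X)^δ`; this uses a positive diameter. -/
lemma IsAhlforsRegular.exists_bounds [IsFiniteMeasure μ] [Nontrivial X]
    (h : IsAhlforsRegular μ δ) : ∃ c C : ℝ, 0 < c ∧ 0 < C ∧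
      (∀ (x : X) (r : ℝ), 0 ≤ r → r < Metric.diam (Set.univ : Set X) →
        c * r ^ δ ≤ μ.real (Metric.closedBall x r)) ∧
      ∀ (x : X) (r : ℝ), 0 ≤ r → μ.real (Metric.closedBall x r) ≤ C * r ^ δ := by
  have hb := h.isBounded
  have hD := diam_univ_pos hb
  obtain ⟨hδ, C, hC, hr⟩ := h
  set D := Metric.diam (Set.univ : Set X) with hDdef
  have hlt : ∀ r : ℝ, 0 ≤ r → r < D → ENNReal.ofReal r < Metric.ediam (Set.univ : Set X) :=
    fun r hr0 hrD => (ENNReal.ofReal_lt_iff_lt_toReal hr0 hb.ediam_ne_top).2 hrD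
  refine ⟨C⁻¹, max C (μ.real Set.univ / D ^ δ), by positivity, by positivity,
    fun x r hr0 hrD => ?_, fun x r hr0 => ?_⟩
  · have := (hr x r hr0 (hlt r hr0 hrD)).1
    rwa [← ofReal_measureReal, ENNReal.ofReal_le_ofReal_iff measureReal_nonneg] at this
  · by_cases hrD : r < D
    · have := (hr x r hr0 (hlt r hr0 hrD)).2
      rw [← ofReal_measureReal, ENNReal.ofReal_le_ofReal_iff (by positivity)] at this
      refine this.trans ?_
      gcongr
      exact le_max_left _ _
    · calc μ.real (Metric.closedBall x r) ≤ μ.real Set.univ := measureReal_mono (Set.subset_univ _)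
        _ = μ.real Set.univ / D ^ δ * D ^ δ := by
          rw [div_mul_cancel₀]
          exact (Real.rpow_pos_of_pos hD δ).ne'
        _ ≤ max C (μ.real Set.univ / D ^ δ) * r ^ δ := by
          gcongr
          · exact le_max_right _ _
          · exact not_lt.1 hrD

end Regular

/-! ### Dini functions and the commutator kernel. -/

section Dini

variable {X : Type*} [MetricSpace X]

lemma modulus_le (f : BoundedContinuousFunction X ℂ) (t : ℝ) : modulus f t ≤ 2 * ‖f‖ₑ := by
  refine iSup_le fun x => iSup_le fun y => iSup_le fun _ => ?_
  rw [two_mul]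
  refine (enorm_sub_le).trans (add_le_add ?_ ?_) <;>
  · rw [← ofReal_norm, ← ofReal_norm]
    exact ENNReal.ofReal_le_ofReal (f.norm_coe_le_norm _)

/-- By monotonicity, `ω(2^{-n-1})` is at most twice the Dini integral over `(2^{-n-1}, 2^{-n}]`, and
these intervals are disjoint. The term `n = 0` is controlled by boundedness of `f`. -/
lemma tsum_modulus_lt_top (f : BoundedContinuousFunction X ℂ) (hf : diniConst f < ∞) :
    ∑' n : ℕ, modulus f ((1 / 2) ^ n) < ∞ := by
  have hhalf : ∀ n : ℕ, modulus f ((1 / 2) ^ (n + 1)) ≤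
      2 * ∫⁻ t in Set.Ioc ((1 / 2 : ℝ) ^ (n + 1)) ((1 / 2) ^ n), modulus f t / ENNReal.ofReal t := by
    intro n
    have h1 : modulus f ((1 / 2) ^ (n + 1)) / ENNReal.ofReal ((1 / 2) ^ n) *
        volume (Set.Ioc ((1 / 2 : ℝ) ^ (n + 1)) ((1 / 2) ^ n)) ≤
        ∫⁻ t in Set.Ioc ((1 / 2 : ℝ) ^ (n + 1)) ((1 / 2) ^ n), modulus f t / ENNReal.ofReal t := by
      rw [← setLIntegral_const]
      refine setLIntegral_mono ((measurable_modulus _).div ENNReal.measurable_ofReal) fun t ht => ?_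
      exact ENNReal.div_le_div (modulus_mono _ ht.1.le) (ENNReal.ofReal_le_ofReal ht.2)
    have h2 : volume (Set.Ioc ((1 / 2 : ℝ) ^ (n + 1)) ((1 / 2) ^ n))
        = ENNReal.ofReal ((1 / 2) ^ n) / 2 := by
      rw [Real.volume_Ioc, ← ENNReal.ofReal_ofNat 2, ← ENNReal.ofReal_div_of_pos two_pos]
      congr 1
      ring
    have h3 : ENNReal.ofReal ((1 / 2 : ℝ) ^ n) ≠ 0 := by
      rw [Ne, ENNReal.ofReal_eq_zero, not_le]
      positivity
    rw [h2, mul_div_assoc', ENNReal.div_mul_cancel h3 ENNReal.ofReal_ne_top] at h1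
    calc modulus f ((1 / 2) ^ (n + 1)) = 2 * (modulus f ((1 / 2) ^ (n + 1)) / 2) := by
          rw [mul_comm, ENNReal.div_mul_cancel two_ne_zero ENNReal.ofNat_ne_top]
      _ ≤ _ := by gcongr
  have hanti : Antitone fun n : ℕ => (1 / 2 : ℝ) ^ n :=
    pow_right_anti₀ (by norm_num) (by norm_num)
  rw [tsum_eq_zero_add' ENNReal.summable]
  refine ENNReal.add_lt_top.2 ⟨(modulus_le f _).trans_lt (ENNReal.mul_lt_top (by simp) (by simp)), ?_⟩
  refine (ENNReal.tsum_le_tsum hhalf).trans_lt ?_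
  rw [ENNReal.tsum_mul_left]
  refine ENNReal.mul_lt_top (by simp) ?_
  have hdisj : Pairwise (Function.onFun Disjoint
      fun n : ℕ => Set.Ioc ((1 / 2 : ℝ) ^ (n + 1)) ((1 / 2) ^ n)) :=
    hanti.pairwise_disjoint_on_Ioc_succ
  rw [← lintegral_iUnion (fun _ => measurableSet_Ioc) hdisj]
  refine (lintegral_mono_set ?_).trans_lt hf
  refine Set.iUnion_subset fun n t ht => ⟨?_, ht.2.trans (pow_le_one₀ (by norm_num) (by norm_num))⟩
  exact lt_trans (by positivity) ht.1

lemma diniConst_lt_top_of_lipschitz {f : X → ℂ} {K : NNReal} (hf : LipschitzWith K f) :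
    diniConst f < ∞ := by
  set D := Metric.diam (Set.univ : Set X)
  have hD0 : 0 ≤ D := Metric.diam_nonneg
  have hm : ∀ t ∈ Set.Ioc (0 : ℝ) 1, modulus f t / ENNReal.ofReal t ≤ ENNReal.ofReal (K * D) := by
    intro t ht
    have h0 : ENNReal.ofReal t ≠ 0 := by simpa using ht.1
    rw [ENNReal.div_le_iff h0 ENNReal.ofReal_ne_top,
      ← ENNReal.ofReal_mul (mul_nonneg K.coe_nonneg hD0)]
    refine iSup_le fun x => iSup_le fun y => iSup_le fun hxy => ?_
    rw [← ofReal_norm]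
    refine ENNReal.ofReal_le_ofReal ?_
    have h1 := hf.dist_le_mul x y
    rw [dist_eq_norm] at h1
    calc ‖f x - f y‖ ≤ K * dist x y := h1
      _ ≤ K * (t * D) := by gcongr
      _ = K * D * t := by ring
  refine (setLIntegral_mono measurable_const hm).trans_lt ?_
  rw [setLIntegral_const]
  exact ENNReal.mul_lt_top ENNReal.ofReal_lt_top (by simp)

variable [MeasurableSpace X] [BorelSpace X] {μ : Measure X} {δ : ℝ}

/-- The integral kernel of the commutator with a Dini function satisfies the hypothesis of the
Schur test. -/
lemma exists_lintegral_dini_le [IsFiniteMeasure μ] (hreg : IsAhlforsRegular μ δ)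
    (f : BoundedContinuousFunction X ℂ) (hf : diniConst f < ∞) :
    ∃ M : ℝ, 0 ≤ M ∧ ∀ x, ∫⁻ y, ENNReal.ofReal (‖f x - f y‖ / dist x y ^ δ) ∂μ
      ≤ ENNReal.ofReal M := by
  rcases subsingleton_or_nontrivial X with hX | hX
  · refine ⟨0, le_rfl, fun x => ?_⟩
    have : ∀ y, ENNReal.ofReal (‖f x - f y‖ / dist x y ^ δ) = 0 := fun y => by
      rw [Subsingleton.elim x y]
      simp
    simp [this]
  obtain ⟨c, C, hc, hC, -, hup⟩ := hreg.exists_bounds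
  have hb := hreg.isBounded
  have hD := diam_univ_pos hb
  have hδ := hreg.1
  set D := Metric.diam (Set.univ : Set X) with hDdef
  have hsum := tsum_modulus_lt_top f hf
  refine ⟨(ENNReal.ofReal (C * 2 ^ δ) * ∑' n : ℕ, modulus f ((1 / 2) ^ n)).toReal,
    ENNReal.toReal_nonneg, fun x => ?_⟩
  rw [ENNReal.ofReal_toReal (ENNReal.mul_lt_top ENNReal.ofReal_lt_top hsum).ne]
  -- On the annulus `2^{-n-1} D < d(x,y) ≤ 2^{-n} D` the integrand is at most the `n`-th term.
  -- Enlarging the annulus to a ball lets upper regularity cancel the weight up to `C 2^δ`, leaving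
  -- `∑ ω(2^{-n})`.
  let G : ℕ → X → ℝ≥0∞ := fun n => (Metric.closedBall x ((1 / 2) ^ n * D)).indicator fun _ =>
    modulus f ((1 / 2) ^ n) * ENNReal.ofReal (((1 / 2) ^ (n + 1) * D) ^ δ)⁻¹
  have hpt : ∀ y, ENNReal.ofReal (‖f x - f y‖ / dist x y ^ δ) ≤ ∑' n, G n y := by
    intro y
    rcases eq_or_ne x y with rfl | hxy
    · simp
    have hd : 0 < dist x y := dist_pos.2 hxy
    have hdD : dist x y ≤ D := Metric.dist_le_diam_of_mem hb (Set.mem_univ _) (Set.mem_univ _)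
    obtain ⟨n, hn1, hn2⟩ := exists_nat_pow_near_of_lt_one (div_pos hd hD)
      ((div_le_one hD).2 hdD) (by norm_num : (0 : ℝ) < 1 / 2) (by norm_num)
    rw [lt_div_iff₀ hD] at hn1
    rw [div_le_iff₀ hD] at hn2
    refine le_trans ?_ (ENNReal.le_tsum n)
    simp only [G]
    rw [Set.indicator_of_mem (by rwa [Metric.mem_closedBall, dist_comm]), div_eq_mul_inv,
      ENNReal.ofReal_mul (norm_nonneg _), ofReal_norm]
    gcongr
    exact le_modulus _ hn2
  calc ∫⁻ y, ENNReal.ofReal (‖f x - f y‖ / dist x y ^ δ) ∂μ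
      ≤ ∫⁻ y, ∑' n, G n y ∂μ := lintegral_mono hpt
    _ = ∑' n, ∫⁻ y, G n y ∂μ := lintegral_tsum fun n =>
        (measurable_const.indicator Metric.isClosed_closedBall.measurableSet).aemeasurable
    _ ≤ ∑' n, ENNReal.ofReal (C * 2 ^ δ) * modulus f ((1 / 2) ^ n) := by
        refine ENNReal.tsum_le_tsum fun n => ?_
        simp only [G]
        rw [lintegral_indicator Metric.isClosed_closedBall.measurableSet, setLIntegral_const,
          mul_assoc, ← ofReal_measureReal,
          ← ENNReal.ofReal_mul (by positivity), mul_comm (modulus _ _)]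
        refine mul_le_mul_left (ENNReal.ofReal_le_ofReal ?_) _
        have h1 := hup x ((1 / 2) ^ n * D) (by positivity)
        rw [inv_mul_le_iff₀ (by positivity)]
        refine h1.trans_eq ?_
        have : (1 / 2 : ℝ) ^ n * D = 2 * ((1 / 2) ^ (n + 1) * D) := by ring
        rw [this, Real.mul_rpow two_pos.le (by positivity)]
        ring
    _ = _ := ENNReal.tsum_mul_left

end Dini

/-! ### The Schur test for nonnegative kernels. -/

section Schur

variable {X : Type*} [MeasurableSpace X] {μ : Measure X} [SFinite μ]

lemma lintegral_schur_le {k : X × X → ℝ} (hk : Measurable k) {M : ℝ}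
    (hM : ∀ x, ∫⁻ y, ENNReal.ofReal (k (x, y)) ∂μ ≤ ENNReal.ofReal M)
    (φ : X → ℝ) (hφ : AEMeasurable φ μ) :
    ∫⁻ p, ENNReal.ofReal (k p) * ENNReal.ofReal (φ p.1) ∂(μ.prod μ)
      ≤ ENNReal.ofReal M * ∫⁻ x, ENNReal.ofReal (φ x) ∂μ := by
  rw [lintegral_prod _ (by fun_prop), ← lintegral_const_mul'' _ hφ.ennreal_ofReal]
  refine lintegral_mono fun x => ?_
  rw [lintegral_mul_const (ENNReal.ofReal (φ x)) (by fun_prop)]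
  gcongr
  exact hM x

lemma integrable_schur_fst {k : X × X → ℝ} (hk : Measurable k) (hk0 : ∀ p, 0 ≤ k p) {M : ℝ}
    (hM : ∀ x, ∫⁻ y, ENNReal.ofReal (k (x, y)) ∂μ ≤ ENNReal.ofReal M)
    {φ : X → ℝ} (hφ : Integrable φ μ) (hφ0 : ∀ x, 0 ≤ φ x) :
    Integrable (fun p : X × X => k p * φ p.1) (μ.prod μ) := by
  have hm : AEStronglyMeasurable (fun p : X × X => k p * φ p.1) (μ.prod μ) :=
    hk.aestronglyMeasurable.mul hφ.aestronglyMeasurable.comp_fst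
  rw [← lintegral_ofReal_ne_top_iff_integrable hm
    (Eventually.of_forall fun p => mul_nonneg (hk0 p) (hφ0 p.1))]
  simp_rw [ENNReal.ofReal_mul (hk0 _)]
  refine ((lintegral_schur_le hk hM φ hφ.aemeasurable).trans_lt
    (ENNReal.mul_lt_top ENNReal.ofReal_lt_top ?_)).ne
  exact (hφ.lintegral_lt_top)

lemma integral_schur_fst_le {k : X × X → ℝ} (hk : Measurable k) (hk0 : ∀ p, 0 ≤ k p) {M : ℝ}
    (hM0 : 0 ≤ M) (hM : ∀ x, ∫⁻ y, ENNReal.ofReal (k (x, y)) ∂μ ≤ ENNReal.ofReal M)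
    {φ : X → ℝ} (hφ : Integrable φ μ) (hφ0 : ∀ x, 0 ≤ φ x) :
    ∫ p, k p * φ p.1 ∂(μ.prod μ) ≤ M * ∫ x, φ x ∂μ := by
  have h := lintegral_schur_le hk hM φ hφ.aemeasurable
  simp_rw [← ENNReal.ofReal_mul (hk0 _)] at h
  rwa [← ofReal_integral_eq_lintegral_ofReal (integrable_schur_fst hk hk0 hM hφ hφ0)
    (Eventually.of_forall fun p => mul_nonneg (hk0 p) (hφ0 p.1)),
    ← ofReal_integral_eq_lintegral_ofReal hφ (Eventually.of_forall hφ0),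
    ← ENNReal.ofReal_mul hM0,
    ENNReal.ofReal_le_ofReal_iff (mul_nonneg hM0 (integral_nonneg hφ0))] at h

lemma integrable_schur_snd {k : X × X → ℝ} (hk : Measurable k) (hk0 : ∀ p, 0 ≤ k p)
    (hsym : ∀ x y, k (x, y) = k (y, x)) {M : ℝ}
    (hM : ∀ x, ∫⁻ y, ENNReal.ofReal (k (x, y)) ∂μ ≤ ENNReal.ofReal M)
    {φ : X → ℝ} (hφ : Integrable φ μ) (hφ0 : ∀ x, 0 ≤ φ x) :
    Integrable (fun p : X × X => k p * φ p.2) (μ.prod μ) := by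
  refine (integrable_schur_fst hk hk0 hM hφ hφ0).swap.congr (Eventually.of_forall fun p => ?_)
  simp only [Function.comp_apply, Prod.swap, hsym p.2 p.1]

lemma integral_schur_snd_le {k : X × X → ℝ} (hk : Measurable k) (hk0 : ∀ p, 0 ≤ k p)
    (hsym : ∀ x y, k (x, y) = k (y, x)) {M : ℝ}
    (hM0 : 0 ≤ M) (hM : ∀ x, ∫⁻ y, ENNReal.ofReal (k (x, y)) ∂μ ≤ ENNReal.ofReal M)
    {φ : X → ℝ} (hφ : Integrable φ μ) (hφ0 : ∀ x, 0 ≤ φ x) :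
    ∫ p, k p * φ p.2 ∂(μ.prod μ) ≤ M * ∫ x, φ x ∂μ := by
  rw [← integral_prod_swap]
  refine le_trans (le_of_eq ?_) (integral_schur_fst_le hk hk0 hM0 hM hφ hφ0)
  refine integral_congr_ae (Eventually.of_forall fun p => ?_)
  simp only [Prod.swap, hsym p.2 p.1]

end Schur

/-! ### Density of the form domain. -/

section Density

variable {X : Type*} [MetricSpace X] [MeasurableSpace X] [BorelSpace X]
  [SecondCountableTopology X] {μ : Measure X} [IsFiniteMeasure μ] {δ : ℝ}

lemma measurable_diniKernel (h : BoundedContinuousFunction X ℂ) :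
    Measurable fun p : X × X => ‖h p.1 - h p.2‖ / dist p.1 p.2 ^ δ :=
  (((h.continuous.measurable.comp measurable_fst).sub
    (h.continuous.measurable.comp measurable_snd)).norm).div (measurable_weight δ)

/-- The class of a bounded continuous function is `m_h 1`. -/
def bcfToL2 (h : BoundedContinuousFunction X ℂ) : Lp ℂ 2 μ := mulOp μ h (Lp.const 2 μ 1)

lemma coeFn_bcfToL2 (h : BoundedContinuousFunction X ℂ) : bcfToL2 (μ := μ) h =ᵐ[μ] h := by
  filter_upwards [coeFn_mulOp μ h (Lp.const 2 μ 1), Lp.coeFn_const 2 μ (1 : ℂ)] with x h1 h2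
  rw [bcfToL2, h1, h2]
  simp

/-- One factor of `|h x - h y|²` is bounded by `2 ‖h‖`; the other, divided by `d^δ`, is integrable
by the Dini estimate and finiteness of `μ`. -/
lemma inFormDomain_bcfToL2 (hreg : IsAhlforsRegular μ δ) (h : BoundedContinuousFunction X ℂ)
    (hh : diniConst h < ∞) : InFormDomain μ δ (bcfToL2 h) := by
  obtain ⟨M, hM0, hM⟩ := exists_lintegral_dini_le hreg h hh
  have hi := integrable_schur_fst (measurable_diniKernel (δ := δ) h)
    (fun p => div_nonneg (norm_nonneg _) (Real.rpow_nonneg dist_nonneg _)) hM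
    (integrable_const (2 * ‖h‖)) (fun _ => by positivity)
  refine hi.mono' (((measurable_diff _).norm.pow_const 2).div
    (measurable_weight δ)).aestronglyMeasurable ?_
  have h0 := coeFn_bcfToL2 (μ := μ) h
  filter_upwards [Measure.quasiMeasurePreserving_fst.ae h0,
    Measure.quasiMeasurePreserving_snd.ae h0] with p h1 h2
  have hw : 0 ≤ dist p.1 p.2 ^ δ := Real.rpow_nonneg dist_nonneg _
  rw [h1, h2, Real.norm_of_nonneg (by positivity), div_mul_eq_mul_div, sq]
  gcongr
  refine (norm_sub_le _ _).trans ?_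
  rw [two_mul]
  exact add_le_add (h.norm_coe_le_norm _) (h.norm_coe_le_norm _)

/-- Indicators of closed sets are bounded pointwise limits of Lipschitz, hence Dini, functions. So
`conj u` integrates to zero over every closed set and vanishes almost everywhere. -/
lemma eq_zero_of_forall_inner_formDomain (hreg : IsAhlforsRegular μ δ) {u : Lp ℂ 2 μ}
    (hu : ∀ g, InFormDomain μ δ g → inner ℂ u g = 0) : u = 0 := by
  have hint : Integrable (fun x => starRingEnd ℂ (u x)) μ :=
    (Complex.conjCLE : ℂ →L[ℝ] ℂ).integrable_comp ((Lp.memLp u).integrable (by norm_num))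
  have h0 : (fun x => starRingEnd ℂ (u x)) =ᵐ[μ] 0 := by
    refine ae_eq_zero_of_forall_setIntegral_isClosed_eq_zero hint fun F hF => ?_
    have hpos : ∀ n : ℕ, (0 : ℝ) < 1 / ((n : ℝ) + 1) := fun n => by positivity
    let g : ℕ → BoundedContinuousFunction X ℂ := fun n =>
      BoundedContinuousFunction.ofNormedAddCommGroup
        (fun x => ((thickenedIndicator (hpos n) F x : ℝ) : ℂ)) (by fun_prop) 1 fun x => by
          rw [Complex.norm_real, Real.norm_of_nonneg (NNReal.coe_nonneg _)]
          exact_mod_cast thickenedIndicator_le_one (hpos n) F x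
    have hg : ∀ n x, g n x = ((thickenedIndicator (hpos n) F x : ℝ) : ℂ) := fun n x => rfl
    have hz : ∀ n, ∫ x, starRingEnd ℂ (u x) * g n x ∂μ = 0 := fun n => by
      have hlip : diniConst (g n) < ∞ := by
        have h1 := lipschitzWith_thickenedIndicator (hpos n) F
        have h2 : LipschitzWith (1 / ((n : ℝ) + 1)).toNNReal⁻¹ (g n) := by
          refine LipschitzWith.of_dist_le_mul fun x y => ?_
          rw [hg, hg, dist_eq_norm, ← Complex.ofReal_sub, Complex.norm_real, Real.norm_eq_abs,
            ← NNReal.dist_eq]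
          exact h1.dist_le_mul x y
        exact diniConst_lt_top_of_lipschitz h2
      have := hu _ (inFormDomain_bcfToL2 hreg (g n) hlip)
      rw [L2.inner_def] at this
      rw [← this]
      refine integral_congr_ae ?_
      filter_upwards [coeFn_bcfToL2 (μ := μ) (g n)] with x hx
      rw [hx, RCLike.inner_apply, mul_comm]
    have hlim : Tendsto (fun n => ∫ x, starRingEnd ℂ (u x) * g n x ∂μ) atTop
        (𝓝 (∫ x, F.indicator (fun x => starRingEnd ℂ (u x)) x ∂μ)) := by
      refine tendsto_integral_of_dominated_convergence (fun x => ‖u x‖) (fun n => ?_)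
        ((Lp.memLp u).integrable (by norm_num)).norm (fun n => Eventually.of_forall fun x => ?_)
        (Eventually.of_forall fun x => ?_)
      · exact hint.aestronglyMeasurable.mul (g n).continuous.aestronglyMeasurable
      · rw [norm_mul, RCLike.norm_conj]
        refine mul_le_of_le_one_right (norm_nonneg _) ?_
        rw [hg, Complex.norm_real, Real.norm_of_nonneg (NNReal.coe_nonneg _)]
        exact_mod_cast thickenedIndicator_le_one (hpos n) F x
      · have h1 := tendsto_pi_nhds.1 (thickenedIndicator_tendsto_indicator_closure hpos
          tendsto_one_div_add_atTop_nhds_zero_nat F) x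
        have h2 := ((Complex.continuous_ofReal.comp NNReal.continuous_coe).tendsto _).comp h1
        have h3 := h2.const_mul (starRingEnd ℂ (u x))
        have h4 : starRingEnd ℂ (u x) * (Complex.ofReal ∘ NNReal.toReal)
            ((closure F).indicator (fun _ => 1) x)
            = F.indicator (fun x => starRingEnd ℂ (u x)) x := by
          rw [hF.closure_eq]
          by_cases hx : x ∈ F <;> simp [hx]
        rw [h4] at h3
        exact h3
    simp only [hz] at hlim
    rw [← integral_indicator hF.measurableSet]
    exact (tendsto_nhds_unique hlim tendsto_const_nhds)
  refine Lp.ext ?_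
  filter_upwards [h0, Lp.coeFn_zero ℂ 2 μ] with x hx hx0
  rw [hx0, Pi.zero_apply]
  simpa using hx

end Density

/-! ### A multiscale minorant of the kernel. -/

section Kernel

variable {X : Type*} [MetricSpace X]

/-- A truncation of the kernel `d(x,y)^{-δ}`, Lipschitz in each variable: a sum of bumps at the
scales `r 0, …, r (k - 1)`. -/
def bumpKernel (δ : ℝ) (r : ℕ → ℝ) (k : ℕ) (x y : X) : ℝ :=
  ∑ n ∈ Finset.range k, (r n ^ δ)⁻¹ * max (1 - dist x y / r n) 0

/-- A bound for the oscillation of `bumpKernel` at scale `ε`. -/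
def oscKernel (δ : ℝ) (r : ℕ → ℝ) (k : ℕ) (ε : ℝ) (x y : X) : ℝ :=
  ∑ n ∈ Finset.range k,
    (Metric.closedBall x (2 * r n)).indicator (fun _ => (r n ^ δ)⁻¹ * (ε / r n)) y

variable {δ : ℝ} {r : ℕ → ℝ}

lemma bumpKernel_nonneg (hr : ∀ n, 0 < r n) (k : ℕ) (x y : X) : 0 ≤ bumpKernel δ r k x y :=
  Finset.sum_nonneg fun n _ => mul_nonneg (inv_nonneg.2 (Real.rpow_nonneg (hr n).le _))
    (le_max_right _ _)

lemma oscKernel_nonneg (hr : ∀ n, 0 < r n) {ε : ℝ} (hε : 0 ≤ ε) (k : ℕ) (x y : X) :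
    0 ≤ oscKernel δ r k ε x y :=
  Finset.sum_nonneg fun n _ => Set.indicator_nonneg
    (fun _ _ => mul_nonneg (inv_nonneg.2 (Real.rpow_nonneg (hr n).le _))
      (div_nonneg hε (hr n).le)) _

lemma bumpKernel_le (hr : ∀ n, 0 < r n) (k : ℕ) (x y : X) :
    bumpKernel δ r k x y ≤ ∑ n ∈ Finset.range k, (r n ^ δ)⁻¹ := by
  refine Finset.sum_le_sum fun n _ => ?_
  refine mul_le_of_le_one_right (inv_nonneg.2 (Real.rpow_nonneg (hr n).le _)) ?_
  refine max_le ?_ zero_le_one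
  have : 0 ≤ dist x y / r n := div_nonneg dist_nonneg (hr n).le
  linarith

lemma continuous_bumpKernel (k : ℕ) :
    Continuous fun p : X × X => bumpKernel δ r k p.1 p.2 := by
  unfold bumpKernel
  fun_prop

lemma oscKernel_comm (k : ℕ) (ε : ℝ) (x y : X) :
    oscKernel δ r k ε x y = oscKernel δ r k ε y x := by
  refine Finset.sum_congr rfl fun n _ => ?_
  simp only [Set.indicator, Metric.mem_closedBall, dist_comm]

lemma measurable_oscKernel [MeasurableSpace X] [BorelSpace X] [SecondCountableTopology X]
    (k : ℕ) (ε : ℝ) : Measurable fun p : X × X => oscKernel δ r k ε p.1 p.2 := by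
  unfold oscKernel
  refine Finset.measurable_sum _ fun n _ => ?_
  simp only [Set.indicator, Metric.mem_closedBall]
  refine Measurable.ite ?_ measurable_const measurable_const
  exact measurableSet_le (measurable_snd.dist measurable_fst) measurable_const

lemma sum_inv_rpow_le (hδ : 0 < δ) (hr : ∀ n, 0 < r n) (hr2 : ∀ n, r n = 2 * r (n + 1)) (k : ℕ) :
    ∑ n ∈ Finset.range (k + 1), (r n ^ δ)⁻¹ ≤ 2 ^ δ / (2 ^ δ - 1) * (r k ^ δ)⁻¹ := by
  have hb : (1 : ℝ) < 2 ^ δ := Real.one_lt_rpow (by norm_num) hδ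
  have hb' : (0 : ℝ) < 2 ^ δ - 1 := by linarith
  induction k with
  | zero =>
    simp only [zero_add, Finset.sum_range_one]
    refine le_mul_of_one_le_left (inv_nonneg.2 (Real.rpow_nonneg (hr 0).le _)) ?_
    rw [le_div_iff₀ hb']
    linarith
  | succ k ih =>
    rw [Finset.sum_range_succ]
    have e : (r (k + 1) ^ δ)⁻¹ = 2 ^ δ * (r k ^ δ)⁻¹ := by
      rw [hr2 k, Real.mul_rpow two_pos.le (hr _).le, mul_inv, mul_inv_cancel_left₀ (by positivity)]
    have h0 : 0 ≤ (r k ^ δ)⁻¹ := inv_nonneg.2 (Real.rpow_nonneg (hr _).le _)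
    rw [e]
    refine (add_le_add_left ih _).trans_eq ?_
    field_simp
    ring

/-- Only scales larger than `d(x,y)` contribute. The weights grow geometrically, so their sum is
comparable to the last one, which is below `d(x,y)^{-δ}`. -/
lemma bumpKernel_le_div (hδ : 0 < δ) (hr : ∀ n, 0 < r n) (hr2 : ∀ n, r n = 2 * r (n + 1))
    (k : ℕ) {x y : X} (hxy : x ≠ y) :
    bumpKernel δ r k x y ≤ 2 ^ δ / (2 ^ δ - 1) / dist x y ^ δ := by
  have hb : (1 : ℝ) < 2 ^ δ := Real.one_lt_rpow (by norm_num) hδ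
  have hb' : (0 : ℝ) < 2 ^ δ - 1 := by linarith
  have hd := dist_pos.2 hxy
  induction k with
  | zero => simp only [bumpKernel, Finset.range_zero, Finset.sum_empty]; positivity
  | succ k ih =>
    by_cases h : r k ≤ dist x y
    · have e : bumpKernel δ r (k + 1) x y = bumpKernel δ r k x y := by
        rw [bumpKernel, bumpKernel, Finset.sum_range_succ, max_eq_right, mul_zero, add_zero]
        rw [sub_nonpos, le_div_iff₀ (hr k)]
        linarith
      rwa [e]
    · rw [not_le] at h
      refine (bumpKernel_le hr _ x y).trans ((sum_inv_rpow_le hδ hr hr2 k).trans ?_)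
      rw [div_eq_mul_inv _ (dist x y ^ δ)]
      gcongr

/-- A bump at scale `r n` is `1 / r n`-Lipschitz. If `d(x,y) > 2 r n`, then also `d(x,z) > r n`
because `ε ≤ r n`, and both values vanish. -/
lemma abs_bumpKernel_sub_le (hr : ∀ n, 0 < r n) (k : ℕ) {ε : ℝ} (hε : ∀ n < k, ε ≤ r n)
    (x y z : X) (hyz : dist y z ≤ ε) :
    |bumpKernel δ r k x y - bumpKernel δ r k x z| ≤ oscKernel δ r k ε x y := by
  rw [bumpKernel, bumpKernel, ← Finset.sum_sub_distrib]
  refine (Finset.abs_sum_le_sum_abs _ _).trans (Finset.sum_le_sum fun n hn => ?_)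
  have hn' := hε n (Finset.mem_range.1 hn)
  have h0 := hr n
  have ha : 0 ≤ (r n ^ δ)⁻¹ := inv_nonneg.2 (Real.rpow_nonneg h0.le _)
  have hd1 := dist_triangle x z y
  have hd2 := dist_triangle x y z
  rw [dist_comm z y] at hd1
  rw [← mul_sub, abs_mul, abs_of_nonneg ha]
  by_cases h : y ∈ Metric.closedBall x (2 * r n)
  · rw [Set.indicator_of_mem h]
    refine mul_le_mul_of_nonneg_left ?_ ha
    refine (abs_max_sub_max_le_abs _ _ _).trans ?_
    rw [sub_sub_sub_cancel_left, ← sub_div, abs_div, abs_of_pos h0]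
    gcongr
    rw [abs_le]
    constructor <;> linarith
  · rw [Set.indicator_of_notMem h]
    rw [Metric.mem_closedBall, not_le, dist_comm] at h
    rw [max_eq_right, max_eq_right]
    · simp
    · rw [sub_nonpos, le_div_iff₀ h0]
      linarith
    · rw [sub_nonpos, le_div_iff₀ h0]
      linarith

variable [MeasurableSpace X] [BorelSpace X] {μ : Measure X} [IsFiniteMeasure μ]

/-- Each bump is at least `1/2` on the ball of half its radius, and the weight cancels the lower
bound for the mass of that ball. All `k` scales contribute equally: this is the source of
logarithmic growth. -/
lemma le_integral_bumpKernel {c D : ℝ} (hr : ∀ n, 0 < r n) (hrD : ∀ n, r n < D)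
    (hlow : ∀ (x : X) (s : ℝ), 0 ≤ s → s < D → c * s ^ δ ≤ μ.real (Metric.closedBall x s))
    (k : ℕ) (x : X) : c / (2 * 2 ^ δ) * k ≤ ∫ y, bumpKernel δ r k x y ∂μ := by
  have hcont : ∀ n, Integrable (fun y => (r n ^ δ)⁻¹ * max (1 - dist x y / r n) 0) μ := fun n => by
    refine Integrable.const_mul ?_ _
    refine (integrable_const (1 : ℝ)).mono' (by fun_prop) (Eventually.of_forall fun y => ?_)
    rw [Real.norm_of_nonneg (le_max_right _ _)]
    refine max_le ?_ zero_le_one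
    have : 0 ≤ dist x y / r n := div_nonneg dist_nonneg (hr n).le
    linarith
  unfold bumpKernel
  rw [integral_finsetSum _ fun n _ => hcont n]
  have : c / (2 * 2 ^ δ) * k = ∑ n ∈ Finset.range k, c / (2 * 2 ^ δ) := by
    rw [Finset.sum_const, Finset.card_range, nsmul_eq_mul, mul_comm]
  rw [this]
  refine Finset.sum_le_sum fun n _ => ?_
  have h0 := hr n
  have hm : MeasurableSet (Metric.closedBall x (r n / 2)) := Metric.isClosed_closedBall.measurableSet
  have h1 : ∫ y, (Metric.closedBall x (r n / 2)).indicator (fun _ => (r n ^ δ)⁻¹ * (1 / 2)) y ∂μ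
      ≤ ∫ y, (r n ^ δ)⁻¹ * max (1 - dist x y / r n) 0 ∂μ := by
    refine integral_mono ((integrable_const _).indicator hm) (hcont n) fun y => ?_
    by_cases hy : y ∈ Metric.closedBall x (r n / 2)
    · rw [Set.indicator_of_mem hy]
      refine mul_le_mul_of_nonneg_left (le_max_of_le_left ?_)
        (inv_nonneg.2 (Real.rpow_nonneg h0.le _))
      rw [Metric.mem_closedBall, dist_comm] at hy
      rw [le_sub_comm, div_le_iff₀ h0]
      linarith
    · rw [Set.indicator_of_notMem hy]
      exact mul_nonneg (inv_nonneg.2 (Real.rpow_nonneg h0.le _)) (le_max_right _ _)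
  refine le_trans ?_ h1
  rw [integral_indicator_const _ hm, smul_eq_mul]
  have h2 := hlow x (r n / 2) (by positivity) (by linarith [hrD n])
  have hp : 0 < r n ^ δ := Real.rpow_pos_of_pos h0 δ
  rw [Real.div_rpow h0.le two_pos.le] at h2
  calc c / (2 * 2 ^ δ) = c * (r n ^ δ / 2 ^ δ) * ((r n ^ δ)⁻¹ * (1 / 2)) := by field_simp
    _ ≤ _ := by gcongr

lemma sum_half_pow_div_le (k : ℕ) :
    ∑ n ∈ Finset.range k, (1 / 2 : ℝ) ^ k / (1 / 2) ^ (n + 1) ≤ 2 := by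
  induction k with
  | zero => simp
  | succ k ih =>
    rw [Finset.sum_range_succ, div_self (by positivity)]
    have : ∑ n ∈ Finset.range k, (1 / 2 : ℝ) ^ (k + 1) / (1 / 2) ^ (n + 1)
        = (1 / 2) * ∑ n ∈ Finset.range k, (1 / 2 : ℝ) ^ k / (1 / 2) ^ (n + 1) := by
      rw [Finset.mul_sum]
      refine Finset.sum_congr rfl fun n _ => ?_
      rw [pow_succ (1 / 2 : ℝ) k]
      ring
    rw [this]
    linarith

/-- Here the mass at scale `n` carries the extra factor `ε / r n`, so the bound does not depend on
the number of scales. -/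
lemma lintegral_oscKernel_le {C ε : ℝ} (hr : ∀ n, 0 < r n) (hε : 0 ≤ ε) (hC : 0 ≤ C) (k : ℕ)
    (hεr : ∑ n ∈ Finset.range k, ε / r n ≤ 2)
    (hup : ∀ (x : X) (s : ℝ), 0 ≤ s → μ.real (Metric.closedBall x s) ≤ C * s ^ δ) (x : X) :
    ∫⁻ y, ENNReal.ofReal (oscKernel δ r k ε x y) ∂μ ≤ ENNReal.ofReal (2 * (C * 2 ^ δ)) := by
  have hm : ∀ n, MeasurableSet (Metric.closedBall x (2 * r n)) :=
    fun n => Metric.isClosed_closedBall.measurableSet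
  have hint : ∀ n, Integrable ((Metric.closedBall x (2 * r n)).indicator
      (fun _ => (r n ^ δ)⁻¹ * (ε / r n))) μ := fun n => (integrable_const _).indicator (hm n)
  have hi : Integrable (oscKernel δ r k ε x) μ := by
    have := integrable_finsetSum (Finset.range k) fun n _ => hint n
    exact this
  rw [← ofReal_integral_eq_lintegral_ofReal hi
    (Eventually.of_forall fun y => oscKernel_nonneg hr hε k x y)]
  refine ENNReal.ofReal_le_ofReal ?_
  unfold oscKernel
  rw [integral_finsetSum _ fun n _ => hint n]
  calc ∑ n ∈ Finset.range k, ∫ y, (Metric.closedBall x (2 * r n)).indicator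
        (fun _ => (r n ^ δ)⁻¹ * (ε / r n)) y ∂μ
      ≤ ∑ n ∈ Finset.range k, (ε / r n) * (C * 2 ^ δ) := by
        refine Finset.sum_le_sum fun n _ => ?_
        have h0 := hr n
        have hp : 0 < r n ^ δ := Real.rpow_pos_of_pos h0 δ
        rw [integral_indicator_const _ (hm n), smul_eq_mul]
        calc _ ≤ (C * (2 * r n) ^ δ) * ((r n ^ δ)⁻¹ * (ε / r n)) := by
              gcongr
              exact hup x _ (by positivity)
          _ = (ε / r n) * (C * 2 ^ δ) := by
              rw [Real.mul_rpow two_pos.le h0.le]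
              field_simp
    _ = (∑ n ∈ Finset.range k, ε / r n) * (C * 2 ^ δ) := by rw [Finset.sum_mul]
    _ ≤ 2 * (C * 2 ^ δ) := by gcongr

end Kernel

/-! ### Covering numbers by volume comparison. -/

section Covering

variable {X : Type*} [MetricSpace X] [MeasurableSpace X] [BorelSpace X] {μ : Measure X}
  [IsFiniteMeasure μ] {δ : ℝ}

lemma card_mul_le_of_isSeparated {c ε D : ℝ} (hε : 0 < ε) (hεD : ε / 3 < D)
    (hlow : ∀ (x : X) (s : ℝ), 0 ≤ s → s < D → c * s ^ δ ≤ μ.real (Metric.closedBall x s))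
    (T : Finset X) (hT : ∀ x ∈ T, ∀ y ∈ T, x ≠ y → ε < dist x y) :
    T.card * (c * (ε / 3) ^ δ) ≤ μ.real Set.univ := by
  have hdisj : Set.PairwiseDisjoint (T : Set X) fun x => Metric.closedBall x (ε / 3) := by
    intro x hx y hy hxy
    have := hT x hx y hy hxy
    exact Metric.closedBall_disjoint_closedBall (by linarith)
  calc T.card * (c * (ε / 3) ^ δ) = ∑ x ∈ T, c * (ε / 3) ^ δ := by
        rw [Finset.sum_const, nsmul_eq_mul]
    _ ≤ ∑ x ∈ T, μ.real (Metric.closedBall x (ε / 3)) :=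
        Finset.sum_le_sum fun x _ => hlow x _ (by positivity) hεD
    _ = μ.real (⋃ x ∈ T, Metric.closedBall x (ε / 3)) :=
        (measureReal_biUnion_finset hdisj fun x _ => Metric.isClosed_closedBall.measurableSet).symm
    _ ≤ μ.real Set.univ := measureReal_mono (Set.subset_univ _)

/-- The covering number is at most the packing number, and balls of radius `ε / 3` around separated
points are disjoint with mass bounded below. The values `e j` for `j ≥ N` are irrelevant. -/
lemma exists_finite_cover [Nonempty X] {c ε D : ℝ} (hc : 0 < c) (hε : 0 < ε) (hεD : ε / 3 < D)
    (hlow : ∀ (x : X) (s : ℝ), 0 ≤ s → s < D → c * s ^ δ ≤ μ.real (Metric.closedBall x s)) :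
    ∃ N : ℕ, (N : ℝ) * (c * (ε / 3) ^ δ) ≤ μ.real Set.univ ∧ ∃ e : ℕ → X,
      ∀ x, ∃ j < N, dist x (e j) ≤ ε := by
  have hq : 0 < c * (ε / 3) ^ δ := by positivity
  have hpack : Metric.packingNumber ε.toNNReal (Set.univ : Set X)
      ≤ (⌊μ.real Set.univ / (c * (ε / 3) ^ δ)⌋₊ : ℕ) := by
    refine iSup_le fun T => iSup_le fun _ => iSup_le fun hT => ?_
    by_contra! hlt
    -- A separated set may a priori be infinite; a finite subset with one point too many already
    -- gives the contradiction.
    obtain ⟨S, hST, hS⟩ := Set.exists_subset_encard_eq (Order.add_one_le_of_lt hlt)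
    have hSfin : S.Finite := Set.finite_of_encard_eq_coe (by exact_mod_cast hS)
    have h1 := card_mul_le_of_isSeparated hε hεD hlow hSfin.toFinset fun x hx y hy hxy => by
      have : ENNReal.ofReal ε < edist x y :=
        hT (hST (hSfin.mem_toFinset.1 hx)) (hST (hSfin.mem_toFinset.1 hy)) hxy
      rw [edist_dist] at this
      exact (ENNReal.ofReal_lt_ofReal_iff_of_nonneg hε.le).1 this
    have h2 : (hSfin.toFinset.card : ℕ∞) = (⌊μ.real Set.univ / (c * (ε / 3) ^ δ)⌋₊ : ℕ) + 1 := by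
      rw [← hS, hSfin.encard_eq_coe_toFinset_card]
    have h3 : hSfin.toFinset.card = ⌊μ.real Set.univ / (c * (ε / 3) ^ δ)⌋₊ + 1 := by
      exact_mod_cast h2
    rw [← le_div_iff₀ hq, h3] at h1
    have := Nat.lt_floor_add_one (μ.real Set.univ / (c * (ε / 3) ^ δ))
    push_cast at h1
    linarith
  have hcov := (Metric.coveringNumber_le_packingNumber ε.toNNReal (Set.univ : Set X)).trans hpack
  have hne : Metric.coveringNumber ε.toNNReal (Set.univ : Set X) ≠ ⊤ :=
    (hcov.trans_lt (ENat.natCast_lt_top _)).ne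
  obtain ⟨T, -, hTfin, hTc, hTcard⟩ := Metric.exists_set_encard_eq_coveringNumber hne
  rw [← hTcard, hTfin.encard_eq_coe_toFinset_card] at hcov
  have hcov' : hTfin.toFinset.card ≤ ⌊μ.real Set.univ / (c * (ε / 3) ^ δ)⌋₊ := by
    exact_mod_cast hcov
  refine ⟨hTfin.toFinset.card, ?_, fun j => if h : j < hTfin.toFinset.card then
    (hTfin.toFinset.equivFin.symm ⟨j, h⟩ : X) else Classical.arbitrary X, fun x => ?_⟩
  · rw [← le_div_iff₀ hq]
    exact (Nat.le_floor_iff (by positivity)).1 hcov'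
  · obtain ⟨y, hy, hxy⟩ := hTc (Set.mem_univ x)
    have hy' : y ∈ hTfin.toFinset := hTfin.mem_toFinset.2 hy
    refine ⟨(hTfin.toFinset.equivFin ⟨y, hy'⟩ : ℕ), (hTfin.toFinset.equivFin ⟨y, hy'⟩).2, ?_⟩
    simp only [Fin.is_lt, dite_true, Fin.eta, Equiv.symm_apply_apply]
    have : edist x y ≤ ENNReal.ofReal ε := hxy
    rwa [edist_dist, ENNReal.ofReal_le_ofReal_iff hε.le] at this

end Covering

/-! ### Coercivity of the form on functions with vanishing cell means. -/

section Gap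

variable {X : Type*} [MeasurableSpace X] {μ : Measure X}

lemma integral_mul_comp_simpleFunc_eq_zero (π : SimpleFunc X X) {f : X → ℂ}
    (hf : Integrable f μ) (hπ : ∀ p, ∫ y in π ⁻¹' {p}, f y ∂μ = 0) (κ : X → ℝ) :
    ∫ y, (κ (π y) : ℂ) * f y ∂μ = 0 := by
  have e : ∀ y, (κ (π y) : ℂ) * f y
      = ∑ p ∈ π.range, (κ p : ℂ) * (π ⁻¹' {p}).indicator f y := fun y => by
    rw [Finset.sum_eq_single (π y)]
    · rw [Set.indicator_of_mem (by simp)]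
    · intro p _ hp
      rw [Set.indicator_of_notMem (by simpa using hp.symm), mul_zero]
    · intro h
      exact absurd (π.mem_range_self y) h
  simp_rw [e]
  rw [integral_finsetSum]
  · refine Finset.sum_eq_zero fun p _ => ?_
    rw [integral_const_mul, integral_indicator (π.measurableSet_preimage _), hπ, mul_zero]
  · exact fun p _ => (hf.indicator (π.measurableSet_preimage _)).const_mul _

lemma integrable_norm_sq (f : Lp ℂ 2 μ) : Integrable (fun x => ‖f x‖ ^ 2) μ :=
  (Lp.memLp f).integrable_norm_pow (by norm_num)

lemma integral_norm_sq (f : Lp ℂ 2 μ) : ∫ x, ‖f x‖ ^ 2 ∂μ = ‖f‖ ^ 2 := by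
  have h := L2.inner_def (𝕜 := ℂ) f f
  rw [inner_self_eq_norm_sq_to_K] at h
  have h2 : ∀ x, inner ℂ (f x) (f x) = ((‖f x‖ ^ 2 : ℝ) : ℂ) := fun x => by
    rw [inner_self_eq_norm_sq_to_K]
    simp
  rw [integral_congr_ae (Eventually.of_forall h2), integral_complex_ofReal] at h
  apply Complex.ofReal_injective
  rw [← h]
  simp

variable [IsFiniteMeasure μ]

lemma integrable_kernel_mul {q : X × X → ℝ} (hq : Measurable q) {A : ℝ} (hqA : ∀ p, ‖q p‖ ≤ A)
    (f : Lp ℂ 2 μ) :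
    Integrable (fun p : X × X => (q p : ℂ) * (starRingEnd ℂ (f p.1) * f p.2)) (μ.prod μ) := by
  have hfi : Integrable (fun x => f x) μ := (Lp.memLp f).integrable (by norm_num)
  have hfc : Integrable (fun x => starRingEnd ℂ (f x)) μ :=
    (Complex.conjCLE : ℂ →L[ℝ] ℂ).integrable_comp hfi
  exact (hfc.mul_prod hfi).bdd_mul (c := A) (Complex.measurable_ofReal.comp hq).aestronglyMeasurable
    (Eventually.of_forall fun p => by rw [Complex.norm_real]; exact hqA p)

/-- Vanishing means on the fibres of `π` kill the integral with `K x (π y)`. So `K` may be replaced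
by a difference dominated by `L`, to which the Schur test applies. -/
lemma norm_integral_kernel_le {K L : X → X → ℝ} {A M : ℝ} (π : SimpleFunc X X)
    (hK : Measurable fun p : X × X => K p.1 p.2) (hKA : ∀ x y, ‖K x y‖ ≤ A)
    (hL : Measurable fun p : X × X => L p.1 p.2) (hL0 : ∀ x y, 0 ≤ L x y)
    (hLs : ∀ x y, L x y = L y x) (hM : 0 ≤ M)
    (hLM : ∀ x, ∫⁻ y, ENNReal.ofReal (L x y) ∂μ ≤ ENNReal.ofReal M)
    (hKL : ∀ x y, |K x y - K x (π y)| ≤ L x y)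
    (f : Lp ℂ 2 μ) (hf : ∀ p, ∫ y in π ⁻¹' {p}, f y ∂μ = 0) :
    ‖∫ p : X × X, (K p.1 p.2 : ℂ) * (starRingEnd ℂ (f p.1) * f p.2) ∂(μ.prod μ)‖
      ≤ M * ‖f‖ ^ 2 := by
  have hfi : Integrable (fun x => f x) μ := (Lp.memLp f).integrable (by norm_num)
  have hsq := integrable_norm_sq f
  have hKp : Measurable fun p : X × X => K p.1 (π p.2) :=
    hK.comp (measurable_fst.prodMk (π.measurable.comp measurable_snd))
  have hI1 := integrable_kernel_mul hK (fun p => hKA p.1 p.2) f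
  have hI2 := integrable_kernel_mul hKp (fun p => hKA p.1 (π p.2)) f
  have hzero : ∫ p : X × X, (K p.1 (π p.2) : ℂ) * (starRingEnd ℂ (f p.1) * f p.2) ∂(μ.prod μ)
      = 0 := by
    rw [integral_prod _ hI2]
    refine integral_eq_zero_of_ae (Eventually.of_forall fun x => ?_)
    have := integral_mul_comp_simpleFunc_eq_zero π hfi hf (K x)
    simp only [mul_left_comm _ (starRingEnd ℂ (f x))]
    rw [integral_const_mul, this, mul_zero]
    rfl
  have hL0' : ∀ p : X × X, 0 ≤ L p.1 p.2 := fun p => hL0 p.1 p.2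
  have hs0 : ∀ x, 0 ≤ ‖f x‖ ^ 2 := fun _ => by positivity
  have hL1 := integrable_schur_fst hL hL0' hLM hsq hs0
  have hL2 := integrable_schur_snd hL hL0' hLs hLM hsq hs0
  have hL1' := integral_schur_fst_le hL hL0' hM hLM hsq hs0
  have hL2' := integral_schur_snd_le hL hL0' hLs hM hLM hsq hs0
  rw [← sub_zero (∫ p : X × X, (K p.1 p.2 : ℂ) * _ ∂(μ.prod μ)), ← hzero,
    ← integral_sub hI1 hI2]
  calc _ ≤ ∫ p : X × X, (1 / 2) * (L p.1 p.2 * ‖f p.1‖ ^ 2 + L p.1 p.2 * ‖f p.2‖ ^ 2)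
          ∂(μ.prod μ) := by
        refine norm_integral_le_of_norm_le ((hL1.add hL2).const_mul _)
          (Eventually.of_forall fun p => ?_)
        rw [← sub_mul, norm_mul, norm_mul, RCLike.norm_conj, ← Complex.ofReal_sub,
          Complex.norm_real, Real.norm_eq_abs]
        have h1 := hKL p.1 p.2
        have h2 := hL0' p
        calc _ ≤ L p.1 p.2 * (‖f p.1‖ * ‖f p.2‖) := by gcongr
          _ ≤ L p.1 p.2 * ((1 / 2) * (‖f p.1‖ ^ 2 + ‖f p.2‖ ^ 2)) := by
            refine mul_le_mul_of_nonneg_left ?_ h2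
            nlinarith [sq_nonneg (‖f p.1‖ - ‖f p.2‖)]
          _ = _ := by ring
    _ ≤ M * ‖f‖ ^ 2 := by
        rw [integral_const_mul, integral_add hL1 hL2]
        rw [integral_norm_sq] at hL1' hL2'
        linarith

/-- The form with a bounded symmetric kernel. -/
lemma integral_kernel_norm_sub_sq {K : X → X → ℝ} {A : ℝ}
    (hK : Measurable fun p : X × X => K p.1 p.2) (hKA : ∀ x y, ‖K x y‖ ≤ A)
    (hKs : ∀ x y, K x y = K y x) (f : Lp ℂ 2 μ) :
    ∫ p : X × X, K p.1 p.2 * ‖f p.1 - f p.2‖ ^ 2 ∂(μ.prod μ)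
      = 2 * ∫ x, (∫ y, K x y ∂μ) * ‖f x‖ ^ 2 ∂μ
        - 2 * (∫ p : X × X, (K p.1 p.2 : ℂ) * (starRingEnd ℂ (f p.1) * f p.2) ∂(μ.prod μ)).re := by
  have hsq := integrable_norm_sq f
  have hI1 := integrable_kernel_mul hK (fun p => hKA p.1 p.2) f
  have hKi : Integrable (fun p : X × X => K p.1 p.2 * ‖f p.1‖ ^ 2) (μ.prod μ) :=
    (hsq.comp_fst μ).bdd_mul (c := A) hK.aestronglyMeasurable
      (Eventually.of_forall fun p => hKA _ _)
  have hKi' : Integrable (fun p : X × X => K p.1 p.2 * ‖f p.2‖ ^ 2) (μ.prod μ) :=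
    (hsq.comp_snd μ).bdd_mul (c := A) hK.aestronglyMeasurable
      (Eventually.of_forall fun p => hKA _ _)
  have hdiag : ∫ p : X × X, K p.1 p.2 * ‖f p.1‖ ^ 2 ∂(μ.prod μ)
      = ∫ x, (∫ y, K x y ∂μ) * ‖f x‖ ^ 2 ∂μ := by
    rw [integral_prod _ hKi]
    simp only [integral_mul_const]
  have hdiag' : ∫ p : X × X, K p.1 p.2 * ‖f p.2‖ ^ 2 ∂(μ.prod μ)
      = ∫ p : X × X, K p.1 p.2 * ‖f p.1‖ ^ 2 ∂(μ.prod μ) := by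
    rw [← integral_prod_swap]
    refine integral_congr_ae (Eventually.of_forall fun p => ?_)
    simp only [Prod.fst_swap, Prod.snd_swap]
    rw [hKs]
  have hexp : ∀ p : X × X, K p.1 p.2 * ‖f p.1 - f p.2‖ ^ 2
      = K p.1 p.2 * ‖f p.1‖ ^ 2 + K p.1 p.2 * ‖f p.2‖ ^ 2
        - 2 * ((K p.1 p.2 : ℂ) * (starRingEnd ℂ (f p.1) * f p.2)).re := fun p => by
    have h := norm_sub_sq (𝕜 := ℂ) (f p.1) (f p.2)
    rw [h, RCLike.inner_apply, Complex.re_ofReal_mul, mul_comm (f p.2)]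
    simp only [RCLike.re_to_complex]
    ring
  have hre : ∫ p : X × X, ((K p.1 p.2 : ℂ) * (starRingEnd ℂ (f p.1) * f p.2)).re ∂(μ.prod μ)
      = (∫ p : X × X, (K p.1 p.2 : ℂ) * (starRingEnd ℂ (f p.1) * f p.2) ∂(μ.prod μ)).re :=
    integral_re hI1
  have hI3 : Integrable (fun p : X × X =>
      ((K p.1 p.2 : ℂ) * (starRingEnd ℂ (f p.1) * f p.2)).re) (μ.prod μ) := hI1.re
  rw [← hre, ← hdiag, ← integral_const_mul 2 (fun p : X × X => Complex.re _),
    integral_congr_ae (Eventually.of_forall hexp),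
    integral_sub (f := fun p : X × X => K p.1 p.2 * ‖f p.1‖ ^ 2 + K p.1 p.2 * ‖f p.2‖ ^ 2)
      (hKi.add hKi') (hI3.const_mul 2), integral_add hKi hKi', hdiag', two_mul]

variable [MetricSpace X] [BorelSpace X] [SecondCountableTopology X] {δ : ℝ}

/-- Quantitative coercivity of the form on functions with vanishing mean on the pieces of a
partition of mesh `D 2^{-k}`. -/
lemma exists_coercivity [Nontrivial X] (hreg : IsAhlforsRegular μ δ) :
    ∃ c C : ℝ, 0 < c ∧ 0 ≤ C ∧ ∀ (k : ℕ) (π : SimpleFunc X X),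
      (∀ y, dist y (π y) ≤ Metric.diam (Set.univ : Set X) * (1 / 2) ^ k) →
      ∀ f : Lp ℂ 2 μ, InFormDomain μ δ f → (∀ p, ∫ y in π ⁻¹' {p}, f y ∂μ = 0) →
        (c * k - C) * ‖f‖ ^ 2 ≤
          ∫ p : X × X, ‖f p.1 - f p.2‖ ^ 2 / dist p.1 p.2 ^ δ ∂(μ.prod μ) := by
  obtain ⟨c, C, hc, hC, hlow, hup⟩ := hreg.exists_bounds
  have hD := diam_univ_pos hreg.isBounded
  have hδ := hreg.1
  set D := Metric.diam (Set.univ : Set X) with hDdef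
  -- The exponent `n + 1` keeps all radii strictly below the diameter, as the lower mass bound
  -- requires, while the mesh `D / 2^k` is still at most `r n` for `n < k`.
  obtain ⟨r, hrdef⟩ : ∃ r : ℕ → ℝ, ∀ n, r n = D * (1 / 2) ^ (n + 1) := ⟨_, fun _ => rfl⟩
  have hr : ∀ n, 0 < r n := fun n => by rw [hrdef]; positivity
  have hr2 : ∀ n, r n = 2 * r (n + 1) := fun n => by rw [hrdef, hrdef]; ring
  have hrD : ∀ n, r n < D := fun n => by
    rw [hrdef]
    exact mul_lt_of_lt_one_right hD (pow_lt_one₀ (by norm_num) (by norm_num) (by omega))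
  have hb : (1 : ℝ) < 2 ^ δ := Real.one_lt_rpow (by norm_num) hδ
  set C₀ : ℝ := 2 ^ δ / (2 ^ δ - 1) with hC₀
  have hC₀pos : 0 < C₀ := div_pos (by positivity) (by linarith)
  set c₁ : ℝ := c / (2 * 2 ^ δ) with hc₁
  set C₁ : ℝ := 2 * (C * 2 ^ δ) with hC₁
  have hC₁0 : 0 ≤ C₁ := by positivity
  -- The truncated form is at least `2 (c₁ k - C₁) ‖f‖²` and at most `C₀` times the full double
  -- integral.
  refine ⟨2 * c₁ / C₀, 2 * C₁ / C₀, by positivity, by positivity, fun k π hπ f hf hmean => ?_⟩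
  set ε := D * (1 / 2) ^ k with hε
  have hε0 : 0 ≤ ε := by positivity
  have hεr : ∀ n < k, ε ≤ r n := fun n hn => by
    rw [hrdef]
    exact mul_le_mul_of_nonneg_left (pow_le_pow_of_le_one (by norm_num) (by norm_num) hn) hD.le
  have hεsum : ∑ n ∈ Finset.range k, ε / r n ≤ 2 := by
    refine le_trans (le_of_eq (Finset.sum_congr rfl fun n _ => ?_)) (sum_half_pow_div_le k)
    rw [hrdef]
    exact mul_div_mul_left _ _ hD.ne'
  have hKn : ∀ x y : X, ‖bumpKernel δ r k x y‖ ≤ ∑ n ∈ Finset.range k, (r n ^ δ)⁻¹ := fun x y => by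
    rw [Real.norm_of_nonneg (bumpKernel_nonneg hr k x y)]
    exact bumpKernel_le hr k x y
  have hKm : Measurable fun p : X × X => bumpKernel δ r k p.1 p.2 :=
    (continuous_bumpKernel k).measurable
  have hKs : ∀ x y : X, bumpKernel δ r k x y = bumpKernel δ r k y x := fun x y => by
    simp only [bumpKernel, dist_comm]
  have hcross := norm_integral_kernel_le (μ := μ) π hKm hKn (measurable_oscKernel k ε)
    (oscKernel_nonneg hr hε0 k) (oscKernel_comm k ε) hC₁0
    (lintegral_oscKernel_le hr hε0 hC.le k hεsum hup)
    (fun x y => abs_bumpKernel_sub_le (δ := δ) hr k hεr x y (π y) (hπ y)) f hmean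
  have htot := integral_kernel_norm_sub_sq hKm hKn hKs f
  have hsq := integrable_norm_sq f
  have hdiag : c₁ * k * ‖f‖ ^ 2 ≤ ∫ x, (∫ y, bumpKernel δ r k x y ∂μ) * ‖f x‖ ^ 2 ∂μ := by
    rw [← integral_norm_sq, ← integral_const_mul]
    refine integral_mono (hsq.const_mul _) ?_ fun x => ?_
    · refine hsq.bdd_mul (c := μ.real Set.univ * ∑ n ∈ Finset.range k, (r n ^ δ)⁻¹)
        hKm.stronglyMeasurable.integral_prod_right.aestronglyMeasurable
        (Eventually.of_forall fun x => ?_)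
      rw [mul_comm]
      exact norm_integral_le_of_norm_le_const (Eventually.of_forall fun y => hKn x y)
    · have := le_integral_bumpKernel (μ := μ) hr hrD hlow k x
      gcongr
  have hup2 : ∫ p : X × X, bumpKernel δ r k p.1 p.2 * ‖f p.1 - f p.2‖ ^ 2 ∂(μ.prod μ)
      ≤ C₀ * ∫ p : X × X, ‖f p.1 - f p.2‖ ^ 2 / dist p.1 p.2 ^ δ ∂(μ.prod μ) := by
    rw [← integral_const_mul]
    refine integral_mono_of_nonneg (Eventually.of_forall fun p =>
      mul_nonneg (bumpKernel_nonneg hr k _ _) (sq_nonneg _)) (hf.const_mul _)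
      (Eventually.of_forall fun p => ?_)
    simp only
    rcases eq_or_ne p.1 p.2 with h | h
    · simp [h]
    · rw [mul_div_left_comm, mul_comm]
      exact mul_le_mul_of_nonneg_left (bumpKernel_le_div hδ hr hr2 k h) (sq_nonneg _)
  have hre := (abs_le.1 ((Complex.abs_re_le_norm _).trans hcross)).2
  rw [div_mul_eq_mul_div, ← sub_div, div_mul_eq_mul_div, div_le_iff₀' hC₀pos]
  nlinarith

/-- Exponentially many (in `k`) conditions make a function in the form domain satisfy a coercivity
estimate linear in `k`. -/
lemma exists_gap [Nonempty X] (hreg : IsAhlforsRegular μ δ) :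
    ∃ A B c C : ℝ, 0 ≤ A ∧ 1 ≤ B ∧ 0 < c ∧ 0 ≤ C ∧ ∀ k : ℕ, ∃ N : ℕ, (N : ℝ) ≤ A * B ^ k ∧
      ∃ v : Fin N → Lp ℂ 2 μ, ∀ f : Lp ℂ 2 μ, InFormDomain μ δ f →
        (∀ j, inner ℂ (v j) f = 0) → (c * k - C) * ‖f‖ ^ 2 ≤
          (1 / 2) * ∫ p : X × X, ‖f p.1 - f p.2‖ ^ 2 / dist p.1 p.2 ^ δ ∂(μ.prod μ) := by
  have hpos : ∀ f : Lp ℂ 2 μ, 0 ≤ ∫ p : X × X, ‖f p.1 - f p.2‖ ^ 2 / dist p.1 p.2 ^ δ ∂(μ.prod μ) :=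
    fun f => integral_nonneg fun p => by positivity
  rcases subsingleton_or_nontrivial X with hX | hX
  -- On a one-point space the form vanishes, but orthogonality to the constant `1` already forces `f
  -- = 0`.
  · refine ⟨1, 1, 1, 0, by norm_num, le_rfl, one_pos, le_rfl, fun k => ⟨1, by simp,
      fun _ => indicatorConstLp 2 MeasurableSet.univ (measure_ne_top μ _) 1, fun f _ hf => ?_⟩⟩
    have h0 := hf 0
    rw [L2.inner_indicatorConstLp_one, setIntegral_univ] at h0
    have hf0 : f = 0 := by
      obtain ⟨x⟩ := ‹Nonempty X›
      have he : ∀ y, f y = f x := fun y => by rw [Subsingleton.elim y x]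
      simp_rw [he] at h0
      rw [integral_const, smul_eq_zero] at h0
      refine Lp.ext ?_
      rcases h0 with h0 | h0
      · rw [measureReal_eq_zero_iff, Measure.measure_univ_eq_zero] at h0
        simp [EventuallyEq, h0]
      · filter_upwards [Lp.coeFn_zero ℂ 2 μ] with y hy
        rw [he, h0, hy]
        rfl
    have := hpos f
    rw [hf0] at this ⊢
    simpa using this
  · obtain ⟨c₀, C₀, hc₀, hC₀, hlow, -⟩ := hreg.exists_bounds
    obtain ⟨c, C, hc, hC, hcoer⟩ := exists_coercivity hreg
    have hD := diam_univ_pos hreg.isBounded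
    set D := Metric.diam (Set.univ : Set X) with hDdef
    -- `A` and `B` come from the packing bound at radius `D 2^{-k}`; the halves match the factor
    -- `1/2` in the form.
    refine ⟨μ.real Set.univ / (c₀ * (D / 3) ^ δ), 2 ^ δ, c / 2, C / 2, by positivity,
      Real.one_le_rpow (by norm_num) hreg.1.le, by positivity, by positivity, fun k => ?_⟩
    have hhalf : (1 / 2 : ℝ) ^ k ≤ 1 := pow_le_one₀ (by norm_num) (by norm_num)
    have hε : 0 < D * (1 / 2) ^ k := by positivity
    obtain ⟨N, hN, e, he⟩ := exists_finite_cover hc₀ hε (by nlinarith) hlow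
    -- The cells are the fibres of the nearest point map onto `e 0, …, e (N - 1)`, so the mesh is at
    -- most the covering radius and inner products with their indicators are the means over cells,
    -- up to normalisation.
    refine ⟨N, ?_, fun j => indicatorConstLp 2
      ((SimpleFunc.nearestPt e (N - 1)).measurableSet_preimage {e j}) (measure_ne_top μ _) 1,
      fun f hf horth => ?_⟩
    · have e1 : c₀ * (D * (1 / 2) ^ k / 3) ^ δ = c₀ * (D / 3) ^ δ * ((2 ^ δ) ^ k)⁻¹ := by
        have : D * (1 / 2) ^ k / 3 = D / 3 * ((2 : ℝ) ^ k)⁻¹ := by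
          rw [one_div, inv_pow]
          ring
        rw [this, Real.mul_rpow (by positivity) (by positivity), Real.inv_rpow (by positivity),
          ← Real.rpow_natCast, ← Real.rpow_mul two_pos.le, ← Real.rpow_natCast (2 ^ δ),
          ← Real.rpow_mul two_pos.le, mul_comm δ, mul_assoc]
      rw [e1, ← mul_assoc, mul_inv_le_iff₀ (by positivity)] at hN
      rw [div_mul_eq_mul_div, le_div_iff₀ (by positivity)]
      exact hN
    · have hmesh : ∀ y, dist y (SimpleFunc.nearestPt e (N - 1) y) ≤ D * (1 / 2) ^ k := fun y => by
        obtain ⟨j, hj, hy⟩ := he y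
        have h1 := SimpleFunc.edist_nearestPt_le e y (Nat.le_sub_one_of_lt hj)
        rw [edist_dist, edist_dist, ENNReal.ofReal_le_ofReal_iff dist_nonneg] at h1
        rw [dist_comm] at h1 hy
        exact h1.trans (by rwa [dist_comm] at hy ⊢)
      have h1 := hcoer k _ hmesh f hf fun p => ?_
      · linarith
      · by_cases hp : ∃ j : Fin N, e j = p
        · obtain ⟨j, rfl⟩ := hp
          have := horth j
          rwa [L2.inner_indicatorConstLp_one] at this
        · have : SimpleFunc.nearestPt e (N - 1) ⁻¹' {p} = ∅ := by
            refine Set.eq_empty_iff_forall_notMem.2 fun y hy => hp ?_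
            obtain ⟨j, hj, -⟩ := he y
            have hN0 : SimpleFunc.nearestPtInd e (N - 1) y < N :=
              (SimpleFunc.nearestPtInd_le e (N - 1) y).trans_lt (by omega)
            exact ⟨⟨_, hN0⟩, hy⟩
          rw [this, setIntegral_empty]

end Gap

/-! ### Resolvents and compactness. -/

section Resolvent

variable {H : Type*} [NormedAddCommGroup H] [InnerProductSpace ℂ H]

/-- By the resolvent identity, one compact resolvent suffices. -/
lemma IsResolvent.hasCompactResolvent {D : H →ₗ.[ℂ] H} {z₀ : ℂ} {R₀ : H →L[ℂ] H}
    (h : IsResolvent D z₀ R₀) (hc : IsCompactOperator R₀) : HasCompactResolvent D := by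
  refine ⟨⟨z₀, R₀, h⟩, fun z R hR => ?_⟩
  have e : R = R₀ ∘L (ContinuousLinearMap.id ℂ H + (z - z₀) • R) := by
    ext u
    obtain ⟨hu, hu'⟩ := hR.1 u
    have h1 := h.2 ⟨R u, hu⟩
    rw [sub_eq_iff_eq_add.1 hu'] at h1
    simp only [ContinuousLinearMap.comp_apply, add_apply, smul_apply, ContinuousLinearMap.id_apply]
    rw [sub_smul, ← add_sub_assoc]
    exact h1.symm
  rw [e]
  exact hc.comp_clm _

lemma isResolvent_of_mem_graph_iff {D : H →ₗ.[ℂ] H} {R : H →L[ℂ] H}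
    (h : ∀ x y, (x, y) ∈ D.graph ↔ x = R (x + y)) : IsResolvent D (-1) R := by
  constructor
  · intro u
    have h1 : (R u, u - R u) ∈ D.graph := by rw [h, add_sub_cancel]
    obtain ⟨⟨x, hx⟩, h2, h3⟩ := (LinearPMap.mem_graph_iff _).1 h1
    simp only at h2 h3
    subst h2
    exact ⟨hx, by rw [h3]; simp⟩
  · intro x
    rw [neg_smul, one_smul, sub_neg_eq_add, add_comm]
    exact ((h _ _).1 (D.mem_graph x)).symm

end Resolvent

/-! ### The form domain as a Hilbert space and the resolvent of the Laplacian. -/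

section FormDomain

variable {X : Type*} [MetricSpace X] [MeasurableSpace X] [BorelSpace X]
  [SecondCountableTopology X] {μ : Measure X} [IsFiniteMeasure μ] {δ : ℝ}

/-- The weighted difference `(f x - f y) / (2 d(x,y)^δ)^{1/2}`, whose `L²` norm is the square root
of the form. -/
def gradient (δ : ℝ) (f : X → ℂ) (p : X × X) : ℂ :=
  (f p.1 - f p.2) / ((√(2 * dist p.1 p.2 ^ δ) : ℝ) : ℂ)

lemma norm_gradient_sq (f : X → ℂ) (p : X × X) :
    ‖gradient δ f p‖ ^ 2 = (1 / 2) * (‖f p.1 - f p.2‖ ^ 2 / dist p.1 p.2 ^ δ) := by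
  have hw : 0 ≤ dist p.1 p.2 ^ δ := Real.rpow_nonneg dist_nonneg _
  rw [gradient, norm_div, Complex.norm_real, Real.norm_of_nonneg (Real.sqrt_nonneg _), div_pow,
    Real.sq_sqrt (by positivity), ← div_div]
  ring

lemma conj_gradient_mul (f g : X → ℂ) (p : X × X) :
    starRingEnd ℂ (gradient δ f p) * gradient δ g p = (1 / 2) *
      (starRingEnd ℂ (f p.1 - f p.2) * (g p.1 - g p.2) / ((dist p.1 p.2 ^ δ : ℝ) : ℂ)) := by
  have hw : 0 ≤ dist p.1 p.2 ^ δ := Real.rpow_nonneg dist_nonneg _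
  rw [gradient, gradient, map_div₀, Complex.conj_ofReal, div_mul_div_comm, ← Complex.ofReal_mul,
    Real.mul_self_sqrt (by positivity), Complex.ofReal_mul, ← div_div]
  push_cast
  ring

lemma measurable_gradient (f : Lp ℂ 2 μ) : Measurable (gradient δ f) :=
  (measurable_diff f).div (Complex.measurable_ofReal.comp
    ((measurable_weight δ).const_mul 2).sqrt)

variable (μ δ) in
/-- The graph of the closed operator `f ↦ gradient f`. -/
def formGraph : Submodule ℂ (WithLp 2 (Lp ℂ 2 μ × Lp ℂ 2 (μ.prod μ))) where
  carrier := {w | w.snd =ᵐ[μ.prod μ] gradient δ w.fst}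
  zero_mem' := by
    have h := Lp.coeFn_zero ℂ 2 μ
    simp only [Set.mem_ofPred_eq, WithLp.zero_fst, WithLp.zero_snd]
    filter_upwards [Measure.quasiMeasurePreserving_fst.ae h,
      Measure.quasiMeasurePreserving_snd.ae h, Lp.coeFn_zero ℂ 2 (μ.prod μ)] with p h1 h2 h3
    rw [h3, gradient, h1, h2]
    simp
  add_mem' := by
    intro w z hw hz
    simp only [Set.mem_ofPred_eq, WithLp.add_fst, WithLp.add_snd] at hw hz ⊢
    filter_upwards [diff_add w.fst z.fst, Lp.coeFn_add w.snd z.snd, hw, hz] with p h1 h2 h3 h4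
    rw [h2, Pi.add_apply, h3, h4, gradient, gradient, gradient, h1, add_div]
  smul_mem' := by
    intro c w hw
    simp only [Set.mem_ofPred_eq, WithLp.smul_fst, WithLp.smul_snd] at hw ⊢
    filter_upwards [diff_smul c w.fst, Lp.coeFn_smul c w.snd, hw] with p h1 h2 h3
    rw [h2, Pi.smul_apply, h3, gradient, gradient, h1, smul_eq_mul, mul_div_assoc]

/-- Convergence in `L²` of both components gives, after two successive extractions, almost
everywhere convergence of both; the defining relation is pointwise and passes to the limit. -/
lemma isClosed_formGraph : IsClosed (formGraph μ δ : Set (WithLp 2 (Lp ℂ 2 μ × Lp ℂ 2 (μ.prod μ)))) := by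
  refine IsSeqClosed.isClosed fun w z hw hwz => ?_
  have h1 : Tendsto (fun n => (w n).fst) atTop (𝓝 z.fst) :=
    ((WithLp.continuous_fst 2 _ _).tendsto z).comp hwz
  have h2 : Tendsto (fun n => (w n).snd) atTop (𝓝 z.snd) :=
    ((WithLp.continuous_snd 2 _ _).tendsto z).comp hwz
  obtain ⟨s, hs, hs'⟩ := (tendstoInMeasure_of_tendsto_Lp h1).exists_seq_tendsto_ae
  obtain ⟨t, ht, ht'⟩ :=
    (tendstoInMeasure_of_tendsto_Lp (h2.comp hs.tendsto_atTop)).exists_seq_tendsto_ae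
  have hall : ∀ᵐ p ∂(μ.prod μ), ∀ n, (w n).snd p = gradient δ (w n).fst p := ae_all_iff.2 hw
  change z.snd =ᵐ[μ.prod μ] gradient δ z.fst
  filter_upwards [Measure.quasiMeasurePreserving_fst.ae hs',
    Measure.quasiMeasurePreserving_snd.ae hs', ht', hall] with p hp1 hp2 hp3 hp4
  refine tendsto_nhds_unique hp3 ?_
  simp only [Function.comp_apply, hp4]
  exact ((hp1.comp ht.tendsto_atTop).sub (hp2.comp ht.tendsto_atTop)).div_const _

instance : CompleteSpace (formGraph μ δ) := isClosed_formGraph.completeSpace_coe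

lemma mem_formGraph_iff {w : WithLp 2 (Lp ℂ 2 μ × Lp ℂ 2 (μ.prod μ))} :
    w ∈ formGraph μ δ ↔ w.snd =ᵐ[μ.prod μ] gradient δ w.fst := Iff.rfl

lemma InFormDomain.memLp_gradient {f : Lp ℂ 2 μ} (hf : InFormDomain μ δ f) :
    MemLp (gradient δ f) 2 (μ.prod μ) := by
  rw [memLp_two_iff_integrable_sq_norm (measurable_gradient f).aestronglyMeasurable]
  simp_rw [norm_gradient_sq]
  exact hf.const_mul _

lemma inFormDomain_iff {f : Lp ℂ 2 μ} :
    InFormDomain μ δ f ↔ ∃ w : formGraph μ δ, w.1.fst = f := by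
  constructor
  · intro hf
    exact ⟨⟨WithLp.toLp 2 (f, hf.memLp_gradient.toLp), hf.memLp_gradient.coeFn_toLp⟩, rfl⟩
  · rintro ⟨⟨w, hw⟩, rfl⟩
    have h1 := (memLp_two_iff_integrable_sq_norm
      (measurable_gradient w.fst).aestronglyMeasurable).1 ((Lp.memLp w.snd).ae_eq hw)
    simp_rw [norm_gradient_sq] at h1
    refine (h1.const_mul 2).congr (Eventually.of_forall fun p => ?_)
    simp only
    ring

lemma inner_snd_formGraph (w z : formGraph μ δ) :
    inner ℂ w.1.snd z.1.snd = logForm μ δ w.1.fst z.1.fst := by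
  rw [L2.inner_def, logForm, ← integral_const_mul]
  refine integral_congr_ae ?_
  filter_upwards [mem_formGraph_iff.1 w.2, mem_formGraph_iff.1 z.2] with p h1 h2
  rw [h1, h2, RCLike.inner_apply, mul_comm, conj_gradient_mul]

lemma norm_snd_sq_formGraph (w : formGraph μ δ) : ‖w.1.snd‖ ^ 2 = (1 / 2) *
    ∫ p : X × X, ‖w.1.fst p.1 - w.1.fst p.2‖ ^ 2 / dist p.1 p.2 ^ δ ∂(μ.prod μ) := by
  rw [← integral_norm_sq, ← integral_const_mul]
  refine integral_congr_ae ?_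
  filter_upwards [mem_formGraph_iff.1 w.2] with p h1
  rw [h1, norm_gradient_sq]

variable (μ δ) in
/-- The embedding of the form domain into `L²`. -/
def formEmbedding : formGraph μ δ →L[ℂ] Lp ℂ 2 μ :=
  WithLp.fstL 2 ℂ _ _ ∘L (formGraph μ δ).subtypeL

lemma formEmbedding_apply (w : formGraph μ δ) : formEmbedding μ δ w = w.1.fst := rfl

lemma norm_sq_formGraph (w : formGraph μ δ) :
    ‖w‖ ^ 2 = ‖w.1.fst‖ ^ 2 + ‖w.1.snd‖ ^ 2 := by
  rw [Submodule.coe_norm, WithLp.prod_norm_sq_eq_of_L2]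

lemma norm_formEmbedding_le (w : formGraph μ δ) : ‖formEmbedding μ δ w‖ ≤ ‖w‖ := by
  rw [← sq_le_sq₀ (norm_nonneg _) (norm_nonneg _), norm_sq_formGraph]
  exact le_add_of_nonneg_right (sq_nonneg _)

lemma denseRange_formEmbedding (hreg : IsAhlforsRegular μ δ) :
    DenseRange (formEmbedding μ δ) := by
  have h : (formEmbedding μ δ).range.topologicalClosure = ⊤ := by
    rw [Submodule.topologicalClosure_eq_top_iff, eq_bot_iff]
    intro u hu
    refine eq_zero_of_forall_inner_formDomain hreg fun g hg => ?_
    obtain ⟨w, rfl⟩ := inFormDomain_iff.1 hg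
    exact (Submodule.mem_orthogonal' _ _).1 hu _ ⟨w, rfl⟩
  exact Submodule.dense_iff_topologicalClosure_eq_top.2 h

/-- Density of the form domain makes the relation single-valued; only then does `toLinearPMap` have
the prescribed graph. -/
lemma graph_logLaplacian (hreg : IsAhlforsRegular μ δ) :
    (logLaplacian μ δ).graph = logLaplacianGraph μ δ := by
  refine Submodule.toLinearPMap_graph_eq _ ?_
  rintro ⟨f, u⟩ ⟨-, h⟩ (rfl : f = 0)
  refine eq_zero_of_forall_inner_formDomain hreg fun g hg => ?_
  rw [← h g hg, logForm_zero]

lemma mem_graph_logLaplacian_iff (hreg : IsAhlforsRegular μ δ) {f u : Lp ℂ 2 μ} :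
    (f, u) ∈ (logLaplacian μ δ).graph ↔ InFormDomain μ δ f ∧
      ∀ g : Lp ℂ 2 μ, InFormDomain μ δ g → logForm μ δ f g = inner ℂ u g := by
  rw [graph_logLaplacian hreg]
  rfl

lemma inner_formGraph (w z : formGraph μ δ) :
    inner ℂ w z = inner ℂ w.1.fst z.1.fst + logForm μ δ w.1.fst z.1.fst := by
  rw [← inner_snd_formGraph, Submodule.coe_inner, WithLp.prod_inner_apply]
  rfl

/-- Adding `⟪f, g⟫` to both sides of the weak equation turns the left side into the inner product of
the form domain, so the element over `f` is the Riesz representative `J* (f + u)`. -/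
lemma mem_graph_logLaplacian_iff_resolvent (hreg : IsAhlforsRegular μ δ) (f u : Lp ℂ 2 μ) :
    (f, u) ∈ (logLaplacian μ δ).graph ↔
      f = formEmbedding μ δ (ContinuousLinearMap.adjoint (formEmbedding μ δ) (f + u)) := by
  rw [mem_graph_logLaplacian_iff hreg]
  constructor
  · rintro ⟨hf, h⟩
    obtain ⟨w, rfl⟩ := inFormDomain_iff.1 hf
    have : ContinuousLinearMap.adjoint (formEmbedding μ δ) (w.1.fst + u) = w := by
      refine ext_inner_right ℂ fun z => ?_
      rw [ContinuousLinearMap.adjoint_inner_left, inner_formGraph, inner_add_left,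
        formEmbedding_apply, h _ (inFormDomain_iff.2 ⟨z, rfl⟩)]
    rw [this]
    rfl
  · intro h
    set w := ContinuousLinearMap.adjoint (formEmbedding μ δ) (f + u) with hw
    rw [formEmbedding_apply] at h
    refine ⟨inFormDomain_iff.2 ⟨w, h.symm⟩, fun g hg => ?_⟩
    obtain ⟨z, rfl⟩ := inFormDomain_iff.1 hg
    have h1 : inner ℂ w z = inner ℂ (f + u) z.1.fst := by
      rw [hw, ContinuousLinearMap.adjoint_inner_left, formEmbedding_apply]
    rw [inner_formGraph, inner_add_left, ← h] at h1
    exact add_left_cancel h1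

lemma exists_hasLogGap [Nonempty X] (hreg : IsAhlforsRegular μ δ) :
    ∃ A B c C : ℝ, 0 ≤ A ∧ 1 ≤ B ∧ 0 < c ∧ 0 ≤ C ∧ HasLogGap (formEmbedding μ δ) A B c C := by
  obtain ⟨A, B, c, C, hA, hB, hc, hC, h⟩ := exists_gap hreg
  refine ⟨A, B, c, C, hA, hB, hc, hC, fun k => ?_⟩
  obtain ⟨N, hN, v, hv⟩ := h k
  refine ⟨N, hN, v, fun w hw => ?_⟩
  have := hv w.1.fst (inFormDomain_iff.2 ⟨w, rfl⟩) hw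
  rw [← norm_snd_sq_formGraph] at this
  rw [formEmbedding_apply, norm_sq_formGraph]
  exact this.trans (le_add_of_nonneg_left (sq_nonneg _))

lemma hasCompactResolvent_logLaplacian [Nonempty X] (hreg : IsAhlforsRegular μ δ) :
    HasCompactResolvent (logLaplacian μ δ) := by
  obtain ⟨A, B, c, C, -, -, hc, -, hgap⟩ := exists_hasLogGap hreg
  have hR := isResolvent_of_mem_graph_iff (R := formEmbedding μ δ ∘L ContinuousLinearMap.adjoint (formEmbedding μ δ))
    (mem_graph_logLaplacian_iff_resolvent hreg)
  exact hR.hasCompactResolvent ((hgap.isCompactOperator hc).comp_clm _)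

end FormDomain

/-! ### Multiplication by Dini functions and the commutator. -/

section Commutator

variable {X : Type*} [MetricSpace X] [MeasurableSpace X] [BorelSpace X]
  [SecondCountableTopology X] {μ : Measure X} [IsFiniteMeasure μ] {δ : ℝ}

/-- Discrete Leibniz rule: one part of the difference of `h f` is bounded by the form of `f`; in the
other, `|h x - h y|² ≤ 2 ‖h‖ |h x - h y|` reduces to the Schur bound for the Dini kernel. -/
lemma InFormDomain.mulOp (hreg : IsAhlforsRegular μ δ) {h : BoundedContinuousFunction X ℂ}
    (hh : diniConst h < ∞) {f : Lp ℂ 2 μ} (hf : InFormDomain μ δ f) :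
    InFormDomain μ δ (mulOp μ h f) := by
  obtain ⟨M, hM0, hM⟩ := exists_lintegral_dini_le hreg h hh
  have hi := integrable_schur_snd (measurable_diniKernel (δ := δ) h)
    (fun p => div_nonneg (norm_nonneg _) (Real.rpow_nonneg dist_nonneg _))
    (fun x y => by simp only [norm_sub_rev, dist_comm]) hM (integrable_norm_sq f)
    (fun _ => by positivity)
  refine ((hf.const_mul (2 * ‖h‖ ^ 2)).add (hi.const_mul (4 * ‖h‖))).mono'
    (((measurable_diff _).norm.pow_const 2).div (measurable_weight δ)).aestronglyMeasurable ?_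
  have h0 := coeFn_mulOp μ h f
  filter_upwards [Measure.quasiMeasurePreserving_fst.ae h0,
    Measure.quasiMeasurePreserving_snd.ae h0] with p h1 h2
  have hw : 0 ≤ dist p.1 p.2 ^ δ := Real.rpow_nonneg dist_nonneg _
  rw [h1, h2, Real.norm_of_nonneg (by positivity), Pi.add_apply, div_mul_eq_mul_div,
    ← mul_div_assoc, ← mul_div_assoc, ← add_div]
  refine div_le_div_of_nonneg_right ?_ hw
  have e : h p.1 * f p.1 - h p.2 * f p.2 = h p.1 * (f p.1 - f p.2) + (h p.1 - h p.2) * f p.2 := by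
    ring
  have n1 := h.norm_coe_le_norm p.1
  have n2 : ‖h p.1 - h p.2‖ ≤ 2 * ‖h‖ := by
    refine (norm_sub_le _ _).trans ?_
    linarith [h.norm_coe_le_norm p.2]
  calc ‖h p.1 * f p.1 - h p.2 * f p.2‖ ^ 2
      ≤ (‖h p.1‖ * ‖f p.1 - f p.2‖ + ‖h p.1 - h p.2‖ * ‖f p.2‖) ^ 2 := by
        rw [e, ← norm_mul, ← norm_mul]
        gcongr
        exact norm_add_le _ _
    _ ≤ 2 * (‖h p.1‖ ^ 2 * ‖f p.1 - f p.2‖ ^ 2)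
          + 2 * (‖h p.1 - h p.2‖ * ‖h p.1 - h p.2‖ * ‖f p.2‖ ^ 2) := by
        nlinarith [sq_nonneg (‖h p.1‖ * ‖f p.1 - f p.2‖ - ‖h p.1 - h p.2‖ * ‖f p.2‖)]
    _ ≤ 2 * (‖h‖ ^ 2 * ‖f p.1 - f p.2‖ ^ 2)
          + 2 * (‖h p.1 - h p.2‖ * (2 * ‖h‖) * ‖f p.2‖ ^ 2) := by gcongr
    _ = _ := by ring

/-- The integrand of the sesquilinear form `⟪K f, g⟫` of the integral operator `K` with kernel
`(h x - h y) / d(x,y)^δ`. -/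
def commutatorIntegrand (δ : ℝ) (h f g : X → ℂ) (p : X × X) : ℂ :=
  starRingEnd ℂ ((h p.1 - h p.2) * f p.2) * g p.1 / ((dist p.1 p.2 ^ δ : ℝ) : ℂ)

lemma norm_commutatorIntegrand (h f g : X → ℂ) (p : X × X) :
    ‖commutatorIntegrand δ h f g p‖
      = ‖h p.1 - h p.2‖ / dist p.1 p.2 ^ δ * (‖f p.2‖ * ‖g p.1‖) := by
  have hw : 0 ≤ dist p.1 p.2 ^ δ := Real.rpow_nonneg dist_nonneg _
  rw [commutatorIntegrand, norm_div, norm_mul, RCLike.norm_conj, norm_mul,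
    Complex.norm_of_nonneg hw]
  ring

lemma measurable_commutatorIntegrand (h : BoundedContinuousFunction X ℂ) (f g : Lp ℂ 2 μ) :
    Measurable (commutatorIntegrand δ h f g) := by
  have hh := h.continuous.measurable
  have hf := (Lp.stronglyMeasurable f).measurable
  have hg := (Lp.stronglyMeasurable g).measurable
  exact ((Complex.continuous_conj.measurable.comp
    (((hh.comp measurable_fst).sub (hh.comp measurable_snd)).mul (hf.comp measurable_snd))).mul
      (hg.comp measurable_fst)).div (Complex.measurable_ofReal.comp (measurable_weight δ))

/-- Weighted arithmetic-geometric mean inequality; the free parameter `s` later balances the norms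
of `f` and `g`. -/
lemma norm_commutatorIntegrand_le (h f g : X → ℂ) {s : ℝ} (hs : 0 < s) (p : X × X) :
    ‖commutatorIntegrand δ h f g p‖
      ≤ s / 2 * (‖h p.1 - h p.2‖ / dist p.1 p.2 ^ δ * ‖f p.2‖ ^ 2)
        + s⁻¹ / 2 * (‖h p.1 - h p.2‖ / dist p.1 p.2 ^ δ * ‖g p.1‖ ^ 2) := by
  have hw : 0 ≤ dist p.1 p.2 ^ δ := Real.rpow_nonneg dist_nonneg _
  have hk : 0 ≤ ‖h p.1 - h p.2‖ / dist p.1 p.2 ^ δ := div_nonneg (norm_nonneg _) hw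
  rw [norm_commutatorIntegrand]
  have key : ‖f p.2‖ * ‖g p.1‖ ≤ s / 2 * ‖f p.2‖ ^ 2 + s⁻¹ / 2 * ‖g p.1‖ ^ 2 := by
    have h1 : 0 ≤ s⁻¹ / 2 * (s * ‖f p.2‖ - ‖g p.1‖) ^ 2 := by positivity
    have h2 : s⁻¹ / 2 * (s * ‖f p.2‖ - ‖g p.1‖) ^ 2 =
        s / 2 * ‖f p.2‖ ^ 2 + s⁻¹ / 2 * ‖g p.1‖ ^ 2 - ‖f p.2‖ * ‖g p.1‖ := by
      field_simp
      ring
    linarith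
  calc _ ≤ ‖h p.1 - h p.2‖ / dist p.1 p.2 ^ δ *
        (s / 2 * ‖f p.2‖ ^ 2 + s⁻¹ / 2 * ‖g p.1‖ ^ 2) := mul_le_mul_of_nonneg_left key hk
    _ = _ := by ring

/-- The integral operator with kernel `(h x - h y) / d(x,y)^δ` is bounded. -/
lemma exists_commutator (hreg : IsAhlforsRegular μ δ) {h : BoundedContinuousFunction X ℂ}
    (hh : diniConst h < ∞) :
    (∀ f g : Lp ℂ 2 μ, Integrable (commutatorIntegrand δ h f g) (μ.prod μ)) ∧
    ∃ K : Lp ℂ 2 μ →L[ℂ] Lp ℂ 2 μ, ∀ f g : Lp ℂ 2 μ,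
      inner ℂ (K f) g = ∫ p, commutatorIntegrand δ h f g p ∂(μ.prod μ) := by
  obtain ⟨M, hM0, hM⟩ := exists_lintegral_dini_le hreg h hh
  have hk0 : ∀ p : X × X, 0 ≤ ‖h p.1 - h p.2‖ / dist p.1 p.2 ^ δ :=
    fun p => div_nonneg (norm_nonneg _) (Real.rpow_nonneg dist_nonneg _)
  have hks : ∀ x y : X, ‖h x - h y‖ / dist x y ^ δ = ‖h y - h x‖ / dist y x ^ δ := fun x y => by
    simp only [norm_sub_rev, dist_comm]
  have hkm := measurable_diniKernel (δ := δ) h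
  have hn0 : ∀ (f : Lp ℂ 2 μ) x, 0 ≤ ‖f x‖ ^ 2 := fun _ _ => by positivity
  have hsnd := fun f : Lp ℂ 2 μ =>
    integrable_schur_snd hkm hk0 hks hM (integrable_norm_sq f) (hn0 f)
  have hfst := fun f : Lp ℂ 2 μ => integrable_schur_fst hkm hk0 hM (integrable_norm_sq f) (hn0 f)
  have hint : ∀ f g : Lp ℂ 2 μ, Integrable (commutatorIntegrand δ h f g) (μ.prod μ) := fun f g =>
    (((hsnd f).const_mul (1 / 2)).add ((hfst g).const_mul (1⁻¹ / 2))).mono'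
      (measurable_commutatorIntegrand h f g).aestronglyMeasurable
      (Eventually.of_forall fun p => norm_commutatorIntegrand_le h f g one_pos p)
  have hbound' : ∀ (f g : Lp ℂ 2 μ) (s : ℝ), 0 < s →
      ‖∫ p, commutatorIntegrand δ h f g p ∂(μ.prod μ)‖
        ≤ s / 2 * (M * ‖f‖ ^ 2) + s⁻¹ / 2 * (M * ‖g‖ ^ 2) := fun f g s hs => by
    have h1 := integral_schur_snd_le hkm hk0 hks hM0 hM (integrable_norm_sq f) (hn0 f)
    have h2 := integral_schur_fst_le hkm hk0 hM0 hM (integrable_norm_sq g) (hn0 g)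
    rw [integral_norm_sq] at h1 h2
    refine (norm_integral_le_of_norm_le (((hsnd f).const_mul (s / 2)).add
      ((hfst g).const_mul (s⁻¹ / 2)))
      (Eventually.of_forall fun p => norm_commutatorIntegrand_le h f g hs p)).trans ?_
    simp only [Pi.add_apply]
    rw [integral_add ((hsnd f).const_mul (s / 2)) ((hfst g).const_mul (s⁻¹ / 2)),
      integral_const_mul, integral_const_mul]
    gcongr
  have hadd_left : ∀ f f' g : Lp ℂ 2 μ, ∫ p, commutatorIntegrand δ h (f + f' : Lp ℂ 2 μ) g p ∂(μ.prod μ)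
      = ∫ p, commutatorIntegrand δ h f g p ∂(μ.prod μ)
        + ∫ p, commutatorIntegrand δ h f' g p ∂(μ.prod μ) := fun f f' g => by
    rw [← integral_add (hint f g) (hint f' g)]
    refine integral_congr_ae ?_
    filter_upwards [Measure.quasiMeasurePreserving_snd.ae (Lp.coeFn_add f f')] with p hp
    simp only [commutatorIntegrand]
    rw [hp, Pi.add_apply, mul_add, map_add]
    ring
  have hadd_right : ∀ f g g' : Lp ℂ 2 μ, ∫ p, commutatorIntegrand δ h f (g + g' : Lp ℂ 2 μ) p ∂(μ.prod μ)
      = ∫ p, commutatorIntegrand δ h f g p ∂(μ.prod μ)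
        + ∫ p, commutatorIntegrand δ h f g' p ∂(μ.prod μ) := fun f g g' => by
    rw [← integral_add (hint f g) (hint f g')]
    refine integral_congr_ae ?_
    filter_upwards [Measure.quasiMeasurePreserving_fst.ae (Lp.coeFn_add g g')] with p hp
    simp only [commutatorIntegrand]
    rw [hp, Pi.add_apply]
    ring
  have hsmul_left : ∀ (c : ℂ) (f g : Lp ℂ 2 μ),
      ∫ p, commutatorIntegrand δ h (c • f : Lp ℂ 2 μ) g p ∂(μ.prod μ)
        = starRingEnd ℂ c * ∫ p, commutatorIntegrand δ h f g p ∂(μ.prod μ) := fun c f g => by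
    rw [← integral_const_mul]
    refine integral_congr_ae ?_
    filter_upwards [Measure.quasiMeasurePreserving_snd.ae (Lp.coeFn_smul c f)] with p hp
    simp only [commutatorIntegrand]
    rw [hp, Pi.smul_apply, smul_eq_mul, mul_left_comm, map_mul]
    ring
  have hsmul_right : ∀ (c : ℂ) (f g : Lp ℂ 2 μ),
      ∫ p, commutatorIntegrand δ h f (c • g : Lp ℂ 2 μ) p ∂(μ.prod μ)
        = c * ∫ p, commutatorIntegrand δ h f g p ∂(μ.prod μ) := fun c f g => by
    rw [← integral_const_mul]
    refine integral_congr_ae ?_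
    filter_upwards [Measure.quasiMeasurePreserving_fst.ae (Lp.coeFn_smul c g)] with p hp
    simp only [commutatorIntegrand]
    rw [hp, Pi.smul_apply, smul_eq_mul]
    ring
  have hbound : ∀ f g : Lp ℂ 2 μ,
      ‖∫ p, commutatorIntegrand δ h f g p ∂(μ.prod μ)‖ ≤ M * ‖f‖ * ‖g‖ := fun f g => by
    rcases eq_or_ne f 0 with rfl | hf
    · have := hsmul_left 0 0 g
      rw [zero_smul, map_zero, zero_mul] at this
      rw [this]
      simp
    rcases eq_or_ne g 0 with rfl | hg
    · have := hsmul_right 0 f 0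
      rw [zero_smul, zero_mul] at this
      rw [this]
      simp
    have hf' := norm_pos_iff.2 hf
    have hg' := norm_pos_iff.2 hg
    -- This weight makes the two terms equal, turning the sum of squares into the product `M ‖f‖
    -- ‖g‖`.
    refine (hbound' f g (‖g‖ / ‖f‖) (by positivity)).trans_eq ?_
    field_simp
    ring
  let β : Lp ℂ 2 μ →ₛₗ[starRingEnd ℂ] Lp ℂ 2 μ →ₗ[ℂ] ℂ :=
    LinearMap.mk₂'ₛₗ (starRingEnd ℂ) (RingHom.id ℂ)
      (fun f g => ∫ p, commutatorIntegrand δ h f g p ∂(μ.prod μ)) hadd_left hsmul_left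
      hadd_right hsmul_right
  let B : Lp ℂ 2 μ →L⋆[ℂ] Lp ℂ 2 μ →L[ℂ] ℂ := LinearMap.mkContinuous₂ β M hbound
  refine ⟨hint, InnerProductSpace.continuousLinearMapOfBilin B, fun f g => ?_⟩
  rw [InnerProductSpace.continuousLinearMapOfBilin_apply]
  rfl

/-- Expanding pointwise, the two form integrands differ by the commutator integrand at `(x, y)` plus
the one at `(y, x)`. They have equal integrals, which absorbs the factor `1/2`. -/
lemma logForm_mulOp (hreg : IsAhlforsRegular μ δ) {h : BoundedContinuousFunction X ℂ}
    (hh : diniConst h < ∞) (hh' : diniConst (star h : BoundedContinuousFunction X ℂ) < ∞)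
    {f g : Lp ℂ 2 μ} (hf : InFormDomain μ δ f) (hg : InFormDomain μ δ g) :
    logForm μ δ (mulOp μ h f) g = logForm μ δ f (mulOp μ (star h) g)
      + ∫ p, commutatorIntegrand δ h f g p ∂(μ.prod μ) := by
  have hint := (exists_commutator hreg hh).1 f g
  have hI1 := integrable_form (hf.mulOp hreg hh) hg
  have hI2 := integrable_form hf (hg.mulOp hreg hh')
  have key : ∫ p : X × X, starRingEnd ℂ (mulOp μ h f p.1 - mulOp μ h f p.2) * (g p.1 - g p.2) /
      ((dist p.1 p.2 ^ δ : ℝ) : ℂ) ∂(μ.prod μ)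
      = ∫ p : X × X, (starRingEnd ℂ (f p.1 - f p.2) *
          (mulOp μ (star h) g p.1 - mulOp μ (star h) g p.2) / ((dist p.1 p.2 ^ δ : ℝ) : ℂ)
        + (commutatorIntegrand δ h f g p + commutatorIntegrand δ h f g p.swap)) ∂(μ.prod μ) := by
    refine integral_congr_ae ?_
    have h1 := coeFn_mulOp μ h f
    have h2 := coeFn_mulOp μ (star h) g
    filter_upwards [Measure.quasiMeasurePreserving_fst.ae h1,
      Measure.quasiMeasurePreserving_snd.ae h1, Measure.quasiMeasurePreserving_fst.ae h2,
      Measure.quasiMeasurePreserving_snd.ae h2] with p h3 h4 h5 h6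
    rw [h3, h4, h5, h6]
    simp only [commutatorIntegrand, BoundedContinuousFunction.star_apply, Prod.fst_swap,
      Prod.snd_swap, dist_comm p.2 p.1, ← add_div, RCLike.star_def, map_sub, map_mul]
    congr 1
    ring
  have hswap : ∫ p : X × X, commutatorIntegrand δ h f g p.swap ∂(μ.prod μ)
      = ∫ p, commutatorIntegrand δ h f g p ∂(μ.prod μ) := integral_prod_swap _
  have hint' : Integrable (fun p : X × X => commutatorIntegrand δ h f g p.swap) (μ.prod μ) :=
    hint.swap
  have hint₂ : Integrable (fun p : X × X =>
      commutatorIntegrand δ h f g p + commutatorIntegrand δ h f g p.swap) (μ.prod μ) :=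
    hint.add hint'
  rw [logForm, key, integral_add hI2 hint₂, integral_add hint hint', hswap, logForm]
  ring

lemma exists_mem_graph_mulOp (hreg : IsAhlforsRegular μ δ) {h : BoundedContinuousFunction X ℂ}
    (hh : diniConst h < ∞) (hh' : diniConst (star h : BoundedContinuousFunction X ℂ) < ∞) :
    ∃ K : Lp ℂ 2 μ →L[ℂ] Lp ℂ 2 μ, ∀ f u, (f, u) ∈ (logLaplacian μ δ).graph →
      (mulOp μ h f, mulOp μ h u + K f) ∈ (logLaplacian μ δ).graph := by
  obtain ⟨-, K, hK⟩ := exists_commutator hreg hh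
  refine ⟨K, fun f u hfu => ?_⟩
  rw [mem_graph_logLaplacian_iff hreg] at hfu ⊢
  refine ⟨hfu.1.mulOp hreg hh, fun g hg => ?_⟩
  rw [logForm_mulOp hreg hh hh' hfu.1 hg, hfu.2 _ (hg.mulOp hreg hh'), inner_add_left, hK,
    mulOp_star, ContinuousLinearMap.star_eq_adjoint, ContinuousLinearMap.adjoint_inner_right]

/-- Balls of small positive radius have positive mass. On a one-point space regularity is vacuous,
and `μ ≠ 0` is used instead. -/
lemma IsAhlforsRegular.isOpenPosMeasure (hreg : IsAhlforsRegular μ δ) (hμ : μ ≠ 0) :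
    μ.IsOpenPosMeasure := by
  refine ⟨fun U hU ⟨x, hx⟩ h0 => ?_⟩
  rcases subsingleton_or_nontrivial X with hX | hX
  · have hU' : U = Set.univ := Set.eq_univ_of_forall fun y => Subsingleton.elim x y ▸ hx
    rw [hU'] at h0
    exact hμ (Measure.measure_univ_eq_zero.1 h0)
  · obtain ⟨c, C, hc, -, hlow, -⟩ := hreg.exists_bounds
    have hD := diam_univ_pos hreg.isBounded
    obtain ⟨ε, hε, hεU⟩ := Metric.isOpen_iff.1 hU x hx
    obtain ⟨r, hr0, hr⟩ := exists_between (lt_min hε hD)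
    have h1 := hlow x r hr0.le (hr.trans_le (min_le_right _ _))
    have h2 : μ.real (Metric.closedBall x r) = 0 := by
      rw [measureReal_eq_zero_iff]
      exact measure_mono_null ((Metric.closedBall_subset_ball
        (hr.trans_le (min_le_left _ _))).trans hεU) h0
    have h3 : 0 < c * r ^ δ := by positivity
    linarith

/-- Applying `m_h` to the constant `1` recovers `h` almost everywhere, hence everywhere by
continuity and full support of `μ`. -/
lemma injective_diniRep (hreg : IsAhlforsRegular μ δ) (hμ : μ ≠ 0) :
    Function.Injective (diniRep μ) := by
  intro h k hhk
  have := hreg.isOpenPosMeasure hμ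
  have h1 : bcfToL2 (μ := μ) (h : BoundedContinuousFunction X ℂ) = bcfToL2 k :=
    congrArg (fun T : Lp ℂ 2 μ →L[ℂ] Lp ℂ 2 μ => T (Lp.const 2 μ 1)) hhk
  have h2 : (h : BoundedContinuousFunction X ℂ) =ᵐ[μ] (k : BoundedContinuousFunction X ℂ) :=
    (coeFn_bcfToL2 _).symm.trans ((congrArg (fun f : Lp ℂ 2 μ => ⇑f) h1).eventuallyEq.trans
      (coeFn_bcfToL2 _))
  have h3 := (Continuous.ae_eq_iff_eq μ (BoundedContinuousFunction.continuous _)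
    (BoundedContinuousFunction.continuous _)).1 h2
  exact Subtype.ext (DFunLike.coe_injective h3)

lemma isSpectralTriple_logLaplacian [Nonempty X] (hμ : μ ≠ 0) (hreg : IsAhlforsRegular μ δ)
    (hsa : IsSelfAdjoint (logLaplacian μ δ)) :
    IsSpectralTriple (diniRep μ) (logLaplacian μ δ) := by
  have hmem : ∀ a : diniAlgebra X, ∃ K : Lp ℂ 2 μ →L[ℂ] Lp ℂ 2 μ,
      ∀ f u, (f, u) ∈ (logLaplacian μ δ).graph →
        (diniRep μ a f, diniRep μ a u + K f) ∈ (logLaplacian μ δ).graph := fun a =>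
    exists_mem_graph_mulOp hreg a.2.2 (star a).2.2
  refine ⟨injective_diniRep hreg hμ, hsa, hasCompactResolvent_logLaplacian hreg,
    fun a x => ?_, fun a => ?_⟩
  · obtain ⟨K, hK⟩ := hmem a
    exact LinearPMap.mem_domain_of_mem_graph (hK _ _ ((logLaplacian μ δ).mem_graph x))
  · obtain ⟨K, hK⟩ := hmem a
    refine ⟨K, fun x => ?_⟩
    have h1 := hK _ _ ((logLaplacian μ δ).mem_graph x)
    have h2 := (logLaplacian μ δ).mem_graph
      ⟨diniRep μ a x, LinearPMap.mem_domain_of_mem_graph h1⟩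
    rw [LinearPMap.mem_graph_snd_inj _ h2 h1 rfl, add_sub_cancel_left]

end Commutator

end LogLaplacian

end

theorem proposition5p3 {X : Type*} [MetricSpace X] [LocallyCompactSpace X]
    [SecondCountableTopology X] [MeasurableSpace X] [BorelSpace X]
    (μ : MeasureTheory.Measure X) [MeasureTheory.IsFiniteMeasure μ] (hμ : μ ≠ 0)
    (δ : ℝ) (hreg : LogLaplacian.IsAhlforsRegular μ δ) :
    LogLaplacian.IsSpectralTriple (LogLaplacian.diniRep μ) (LogLaplacian.logLaplacian μ δ) ∧
    LogLaplacian.IsLiSummable (LogLaplacian.logLaplacian μ δ) ∧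
    ∃ S : ℝ → MeasureTheory.Lp ℂ 2 μ →L[ℂ] MeasureTheory.Lp ℂ 2 μ,
      LogLaplacian.IsHeatSemigroup (LogLaplacian.logLaplacian μ δ) S ∧
      ∃ t : ℝ, 0 < t ∧ LogLaplacian.IsTraceClass (S t) := by
  have : Nonempty X := MeasureTheory.nonempty_of_measure_ne_zero
    (mt MeasureTheory.Measure.measure_univ_eq_zero.1 hμ) |>.to_type
  obtain ⟨A, B, c, C, hA, hB, hc, hC, hgap⟩ := LogLaplacian.exists_hasLogGap hreg
  obtain ⟨s, b, a, ha, hdiag, hrepr⟩ := LogLaplacian.isDiagonal_of_graph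
    (hgap.isCompactOperator hc) (LogLaplacian.denseRange_formEmbedding hreg)
    LogLaplacian.norm_formEmbedding_le (LogLaplacian.mem_graph_logLaplacian_iff_resolvent hreg)
  obtain ⟨t, ht, hsum⟩ := hgap.exists_summable hc hC hA hB ha hrepr
  -- The absolute value `|t|` keeps the multipliers bounded by `1` at all real times; only `t ≥ 0`
  -- matters.
  choose S hS using fun t : ℝ => LogLaplacian.exists_diagonal_clm b
    (fun i => Real.exp (-|t| * a i)) fun i => by
      rw [Real.abs_exp, Real.exp_le_one_iff, neg_mul, neg_nonpos]
      exact mul_nonneg (abs_nonneg t) (ha i)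
  have hheat : LogLaplacian.IsHeatSemigroup (LogLaplacian.logLaplacian μ δ) S :=
    hdiag.isHeatSemigroup ha fun t ht x i => by rw [hS, abs_of_nonneg ht]
  have htr : LogLaplacian.IsTraceClass (S t) := by
    refine LogLaplacian.isTraceClass_of_diagonal b (hS t) (fun i => (Real.exp_pos _).le) ?_
    rwa [abs_of_pos ht]
  exact ⟨LogLaplacian.isSpectralTriple_logLaplacian hμ hreg hdiag.isSelfAdjoint,
    ⟨_, S, hdiag.isAbsoluteValue ha, hheat, t, ht, htr⟩, S, hheat, t, ht, htr⟩
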